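/- Let $Y$ be a nonempty complete $\mathrm{CAT}(0)$ space, let $\Gamma$ be a finitely generated group, and let $\rho\colon\Gamma\to\mathrm{Isom}(Y)$ be a homomorphism. Let $\mu\colon\Gamma\times\Gamma\to[0,\infty)$ be a $\Gamma$-invariant, finitely supported, symmetric and irreducible random walk, that is: $\mu(\gamma\gamma',\gamma\gamma'')=\mu(\gamma',\gamma'')$; for each $\gamma$, $\mu(\gamma,\gamma')=0$ for all but finitely many $\gamma'$, and $\sum_{\gamma'}\mu(\gamma,\gamma')=1$; $\mu(\gamma,\gamma')=\mu(\gamma',\gamma)$; and any two elements of $\Gamma$ are joined by a finite sequence $\gamma_0,\dots,\gamma_m$ with $\mu(\gamma_i,\gamma_{i+1})\neq 0$ for all $i<m$. For $l\ge 1$ let $\mu^l$ be the $l$-th convolution power, $\mu^l(\gamma,\gamma')=\sum_{\gamma_1,\dots,\gamma_{l-1}}\mu(\gamma,\gamma_1)\cdots\mu(\gamma_{l-1},\gamma')$. A map $f\colon\Gamma\to Y$ is $\rho$-equivariant if $f(\gamma\gamma')=\rho(\gamma)f(\gamma')$ for all $\gamma,\gamma'\in\Gamma$; for such $f$ put $$E_{\mu^l}(f)=\tfrac12\sum_{\gamma\in\Gamma}\mu^l(e,\gamma)\,d(f(e),f(\gamma))^2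 .$$ For $p\in Y$ let $S_pY$ be the space of directions at $p$, i.e. the completion, with respect to the angle $\angle_p$, of the set of nontrivial geodesics starting from $p$ modulo the relation $\angle_p=0$, and let $TC_pY$ be the tangent cone at $p$, i.e. the cone over $S_pY$ with the distance $d((u,t),(u',t'))^2=t^2+t'^2-2tt'\cos\angle_p(u,u')$ (a single point if $S_pY$ is empty); write $|(u,t)|=t$. Let $\pi_p\colon Y\to TC_pY$ map $q\neq p$ to $([c],d(p,q))$, where $c$ is the geodesic from $p$ to $q$, and $p$ to the cone point. Let $-\Delta_\mu f(e)\in TC_{f(e)}Y$ be the barycenter of the push-forward of $\mu(e,\cdot)$ by $\gamma\mapsto\pi_{f(e)}(f(\gamma))$, that is, the minimizer of $v\mapsto\sum_\gamma\mu(e,\gamma)\,d(\pi_{f(e)}(f(\gamma)),v)^2$. Suppose there exist a positive integer $n$ and a real number $\varepsilon>0$ such that for every $\rho$-equivariant map $f\colon\Gamma\to Y$ there is an integer $l$ with $1\le l\le n$ and $$E_{\mu^l}(f)\le(l-\varepsilon)\,E_\mu(f).$$ Then there is a constant $C>0$ such that $|-\Delta_\mu f(e)|^2\ge C\,E_\mu(f)$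 for every $\rho$-equivariant map $f\colon\Gamma\to Y$. In particular, $\rho(\Gamma)$ has a global fixed point, i.e. there is $p\in Y$ with $\rho(\gamma)p=p$ for all $\gamma\in\Gamma$. -/

import Mathlib

open Filter Topology Set

noncomputable section

namespace NStepEnergy

/-! ### Geodesics and `CAT(0)` spaces -/

/-- `c : [0,l] → Y` is a (constant speed) geodesic joining `p` to `q`; only the values of `c` on
`[0,l]` matter. -/
structure IsGeodesic {Y : Type*} [MetricSpace Y] (c : ℝ → Y) (l : ℝ) (p q : Y) : Prop where
  pos : 0 < l
  source : c 0 = p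
  target : c l = q
  dist_eq : ∀ s ∈ Icc 0 l, ∀ t ∈ Icc 0 l, dist (c s) (c t) = |s - t| * dist p q / l

/-- A `CAT(0)` space: a geodesic space all of whose geodesic triangles satisfy the `CAT(0)`
condition. The side number `i` of the triangle joins the vertex `p i` to the vertex `p (i + 1)`
(indices modulo `3`), and is parametrized proportionally to arc length on `[0,1]`; hence the
comparison point of `c i s` is the point `AffineMap.lineMap (x i) (x (i + 1)) s` of the
corresponding side of the comparison triangle `x`. -/
structure IsCAT0 (Y : Type*) [MetricSpace Y] : Prop where
  exists_geodesic : ∀ p q : Y, ∃ c : ℝ → Y, IsGeodesic c 1 p q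
  comparison : ∀ (p : Fin 3 → Y) (c : Fin 3 → ℝ → Y) (x : Fin 3 → EuclideanSpace ℝ (Fin 2)),
    (∀ i, IsGeodesic (c i) 1 (p i) (p (i + 1))) →
    (∀ i j, dist (x i) (x j) = dist (p i) (p j)) →
    ∀ i j, ∀ s ∈ Icc (0 : ℝ) 1, ∀ t ∈ Icc (0 : ℝ) 1,
      dist (c i s) (c j t) ≤
        dist (AffineMap.lineMap (x i) (x (i + 1)) s : EuclideanSpace ℝ (Fin 2))
          (AffineMap.lineMap (x j) (x (j + 1)) t)

/-! ### Angles, the space of directions, and the tangent cone -/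

/-- The angle between the sides of lengths `a` and `b` in a Euclidean triangle with side lengths
`a`, `b`, `d`. -/
def comparisonAngle (a b d : ℝ) : ℝ :=
  Real.arccos ((a ^ 2 + b ^ 2 - d ^ 2) / (2 * a * b))

/-- The nontrivial geodesics starting from `p`. -/
structure NontrivialGeodesic {Y : Type*} [MetricSpace Y] (p : Y) where
  toFun : ℝ → Y
  len : ℝ
  endpoint : Y
  isGeodesic : IsGeodesic toFun len p endpoint
  nontrivial : p ≠ endpoint

namespace NontrivialGeodesic

variable {Y : Type*} [MetricSpace Y] {p : Y}

/-- The comparison angle at `p` for the points `c t` and `c' t'`. -/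
def angleAt (c c' : NontrivialGeodesic p) (z : ℝ × ℝ) : ℝ :=
  comparisonAngle (dist p (c.toFun z.1)) (dist p (c'.toFun z.2))
    (dist (c.toFun z.1) (c'.toFun z.2))

/-- The angle at `p` between two geodesics starting from `p`, as the upper limit of the comparison
angles when `t, t' → 0`. In a `CAT(0)` space the comparison angles are monotone in `t` and `t'`, so
that this is a limit. -/
def angle (c c' : NontrivialGeodesic p) : ℝ :=
  limsup (angleAt c c') (𝓝[>] (0 : ℝ) ×ˢ 𝓝[>] (0 : ℝ))

/-- The speed of a nontrivial geodesic. -/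
def speed (c : NontrivialGeodesic p) : ℝ := dist p c.endpoint / c.len

lemma speed_pos (c : NontrivialGeodesic p) : 0 < c.speed :=
  div_pos (dist_pos.2 c.nontrivial) c.isGeodesic.pos

lemma dist_apply (c : NontrivialGeodesic p) {s t : ℝ} (hs : s ∈ Ioo 0 c.len)
    (ht : t ∈ Ioo 0 c.len) : dist (c.toFun s) (c.toFun t) = c.speed * |s - t| := by
  rw [c.isGeodesic.dist_eq s ⟨hs.1.le, hs.2.le⟩ t ⟨ht.1.le, ht.2.le⟩, speed]; ring

lemma dist_source (c : NontrivialGeodesic p) {t : ℝ} (ht : t ∈ Ioo 0 c.len) :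
    dist p (c.toFun t) = c.speed * t := by
  have h := c.isGeodesic.dist_eq 0 ⟨le_rfl, c.isGeodesic.pos.le⟩ t ⟨ht.1.le, ht.2.le⟩
  rw [c.isGeodesic.source, zero_sub, abs_neg, abs_of_pos ht.1] at h
  rw [h, speed]; ring

lemma eventually_mem (c : NontrivialGeodesic p) : ∀ᶠ t in 𝓝[>] (0 : ℝ), t ∈ Ioo 0 c.len :=
  Ioo_mem_nhdsGT c.isGeodesic.pos

lemma angleAt_nonneg (c c' : NontrivialGeodesic p) (z : ℝ × ℝ) : 0 ≤ angleAt c c' z :=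
  Real.arccos_nonneg _

lemma angleAt_le_pi (c c' : NontrivialGeodesic p) (z : ℝ × ℝ) : angleAt c c' z ≤ Real.pi :=
  Real.arccos_le_pi _

lemma isBoundedUnder (c c' : NontrivialGeodesic p) (l : Filter (ℝ × ℝ)) :
    l.IsBoundedUnder (· ≤ ·) (angleAt c c') :=
  isBoundedUnder_of ⟨Real.pi, angleAt_le_pi c c'⟩

lemma isCoboundedUnder (c c' : NontrivialGeodesic p) (l : Filter (ℝ × ℝ)) [l.NeBot] :
    l.IsCoboundedUnder (· ≤ ·) (angleAt c c') :=
  (isBoundedUnder_of (r := (· ≥ ·)) ⟨0, angleAt_nonneg c c'⟩).isCoboundedUnder_le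

lemma angle_nonneg (c c' : NontrivialGeodesic p) : 0 ≤ angle c c' :=
  le_limsup_of_frequently_le (Frequently.of_forall (angleAt_nonneg c c'))
    (isBoundedUnder c c' _)

lemma angle_le_pi (c c' : NontrivialGeodesic p) : angle c c' ≤ Real.pi :=
  limsup_le_of_le (isCoboundedUnder c c' _) (Eventually.of_forall (angleAt_le_pi c c'))

lemma angle_self (c : NontrivialGeodesic p) : angle c c = 0 := by
  have h : ∀ᶠ z in (𝓝[>] (0 : ℝ) ×ˢ 𝓝[>] (0 : ℝ)), angleAt c c z = 0 := by
    filter_upwards [c.eventually_mem.prod_mk c.eventually_mem] with z hz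
    have hv := c.speed_pos
    have h1 := hz.1.1
    have h2 := hz.2.1
    rw [angleAt, comparisonAngle, c.dist_source hz.1, c.dist_source hz.2, c.dist_apply hz.1 hz.2,
      mul_pow _ |_|, sq_abs, Real.arccos_eq_zero]
    rw [le_div_iff₀ (by positivity)]
    nlinarith
  rw [angle, limsup_congr h, limsup_const]

lemma angle_comm (c c' : NontrivialGeodesic p) : angle c c' = angle c' c := by
  have h : angleAt c c' = angleAt c' c ∘ Prod.swap := by
    funext z
    simp only [angleAt, comparisonAngle, Function.comp, Prod.fst_swap, Prod.snd_swap]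
    rw [dist_comm (c.toFun z.1)]
    congr 1
    ring
  rw [angle, h, Filter.limsup_comp, angle]
  congr 1
  exact Filter.prod_comm.symm

/-- In the Euclidean plane, a segment whose endpoints are at distances `a` and `b` from the origin
and are seen from there under the angle `β + β' < π` meets the ray that makes the angles `β` and
`β'` with the directions of the endpoints. -/
lemma exists_split {a b β β' : ℝ} (ha : 0 < a) (hb : 0 < b) (hβ : 0 < β) (hβ' : 0 < β')
    (h : β + β' < Real.pi) : ∃ t, 0 < t ∧ t ≤ max a b ∧
      √(a ^ 2 + t ^ 2 - 2 * a * t * Real.cos β) + √(t ^ 2 + b ^ 2 - 2 * t * b * Real.cos β') =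
        √(a ^ 2 + b ^ 2 - 2 * a * b * Real.cos (β + β')) := by
  have hs : 0 < Real.sin β := Real.sin_pos_of_pos_of_lt_pi hβ (by linarith)
  have hs' : 0 < Real.sin β' := Real.sin_pos_of_pos_of_lt_pi hβ' (by linarith)
  have hss : 0 < Real.sin (β + β') := Real.sin_pos_of_pos_of_lt_pi (by linarith) h
  have e1 := Real.sin_sq_add_cos_sq β
  have e2 := Real.sin_sq_add_cos_sq β'
  set D := a * Real.sin β + b * Real.sin β' with hD
  have hDpos : 0 < D := by positivity
  set t := a * b * Real.sin (β + β') / D with ht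
  set u := b * Real.sin β' / D with hu
  set w := a * Real.sin β / D with hw
  have hu0 : 0 ≤ u := by positivity
  have hw0 : 0 ≤ w := by positivity
  have huw : u + w = 1 := by
    rw [hu, hw, ← add_div, div_eq_one_iff_eq hDpos.ne']; ring
  have hN : ∀ x y : ℝ, ‖(⟨x, y⟩ : ℂ)‖ = √(x ^ 2 + y ^ 2) := fun x y => by
    rw [Complex.norm_eq_sqrt_sq_add_sq]
  let x : ℂ := ⟨a * Real.cos β, a * Real.sin β⟩
  let y : ℂ := ⟨b * Real.cos β', -(b * Real.sin β')⟩
  let m : ℂ := ⟨t, 0⟩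
  have hm : m = u • x + w • y := by
    apply Complex.ext
    · simp only [m, x, y, Complex.add_re, Complex.smul_re, smul_eq_mul]
      rw [ht, hu, hw, Real.sin_add]
      field_simp
      ring
    · simp only [m, x, y, Complex.add_im, Complex.smul_im, smul_eq_mul]
      rw [hu, hw]
      field_simp
      ring
  have hseg : m ∈ segment ℝ x y := ⟨u, w, hu0, hw0, huw, hm.symm⟩
  have htpos : 0 < t := by positivity
  have hx : ‖x‖ = a := by
    simp only [x]
    rw [hN, show (a * Real.cos β) ^ 2 + (a * Real.sin β) ^ 2 = a ^ 2 by
      linear_combination a ^ 2 * e1, Real.sqrt_sq ha.le]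
  have hy : ‖y‖ = b := by
    simp only [y]
    rw [hN, show (b * Real.cos β') ^ 2 + (-(b * Real.sin β')) ^ 2 = b ^ 2 by
      linear_combination b ^ 2 * e2, Real.sqrt_sq hb.le]
  refine ⟨t, htpos, ?_, ?_⟩
  · have h1 : ‖m‖ = t := by
      simp only [m]
      rw [hN, show t ^ 2 + (0 : ℝ) ^ 2 = t ^ 2 by ring, Real.sqrt_sq htpos.le]
    have h2 : ‖m‖ ≤ u * a + w * b := by
      rw [hm]
      refine (norm_add_le _ _).trans ?_
      rw [norm_smul, norm_smul, hx, hy, Real.norm_of_nonneg hu0, Real.norm_of_nonneg hw0]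
    rw [h1] at h2
    nlinarith [le_max_left a b, le_max_right a b]
  · have h3 := dist_add_dist_of_mem_segment hseg
    rw [dist_eq_norm, dist_eq_norm, dist_eq_norm] at h3
    have k1 : x - m = ⟨a * Real.cos β - t, a * Real.sin β - 0⟩ := rfl
    have k2 : m - y = ⟨t - b * Real.cos β', 0 - -(b * Real.sin β')⟩ := rfl
    have k3 : x - y = ⟨a * Real.cos β - b * Real.cos β', a * Real.sin β - -(b * Real.sin β')⟩ :=
      rfl
    rw [k1, k2, k3, hN, hN, hN] at h3
    rw [Real.cos_add]
    convert h3 using 3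
    · linear_combination -a ^ 2 * e1
    · linear_combination -b ^ 2 * e2
    · linear_combination -a ^ 2 * e1 - b ^ 2 * e2

lemma lt_sqrt_of_comparisonAngle_lt {a b d β : ℝ} (ha : 0 < a) (hb : 0 < b)
    (hβ : 0 ≤ β) (hβ' : β ≤ Real.pi) (h : comparisonAngle a b d < β) :
    d < √(a ^ 2 + b ^ 2 - 2 * a * b * Real.cos β) := by
  have h1 : Real.cos β < (a ^ 2 + b ^ 2 - d ^ 2) / (2 * a * b) := by
    by_contra! hc
    have := Real.antitone_arccos hc
    rw [Real.arccos_cos hβ hβ'] at this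
    exact absurd h (not_lt.2 this)
  rw [lt_div_iff₀ (by positivity)] at h1
  apply Real.lt_sqrt_of_sq_lt
  linarith

lemma sqrt_lt_of_lt_comparisonAngle {a b d β : ℝ} (ha : 0 < a) (hb : 0 < b) (hd : 0 ≤ d)
    (hβ : 0 ≤ β) (hβ' : β ≤ Real.pi) (h : β < comparisonAngle a b d) :
    √(a ^ 2 + b ^ 2 - 2 * a * b * Real.cos β) ≤ d := by
  have h1 : (a ^ 2 + b ^ 2 - d ^ 2) / (2 * a * b) < Real.cos β := by
    by_contra! hc
    have := Real.antitone_arccos hc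
    rw [Real.arccos_cos hβ hβ'] at this
    exact absurd h (not_lt.2 this)
  rw [div_lt_iff₀ (by positivity)] at h1
  rw [Real.sqrt_le_left hd]
  linarith

lemma exists_bound (c c' : NontrivialGeodesic p) {β : ℝ} (h : angle c c' < β) :
    ∃ δ > 0, ∀ s ∈ Ioo 0 δ, ∀ t ∈ Ioo 0 δ, angleAt c c' (s, t) < β := by
  have h1 := eventually_lt_of_limsup_lt h (isBoundedUnder c c' _)
  obtain ⟨A, hA, B, hB, hAB⟩ := Filter.mem_prod_iff.1 h1
  obtain ⟨x, hx, hxA⟩ := mem_nhdsGT_iff_exists_Ioo_subset.1 hA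
  obtain ⟨y, hy, hyB⟩ := mem_nhdsGT_iff_exists_Ioo_subset.1 hB
  exact ⟨min x y, lt_min hx hy, fun s hs t ht => hAB ⟨hxA ⟨hs.1, hs.2.trans_le (min_le_left _ _)⟩,
    hyB ⟨ht.1, ht.2.trans_le (min_le_right _ _)⟩⟩⟩

lemma angle_triangle (c₁ c₂ c₃ : NontrivialGeodesic p) :
    angle c₁ c₃ ≤ angle c₁ c₂ + angle c₂ c₃ := by
  by_contra! hlt
  set η := (angle c₁ c₃ - (angle c₁ c₂ + angle c₂ c₃)) / 3 with hη
  have hη0 : 0 < η := by rw [hη]; linarith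
  set β := angle c₁ c₂ + η with hβ
  set β' := angle c₂ c₃ + η with hβ'
  have b0 : 0 < β := by linarith [angle_nonneg c₁ c₂]
  have b0' : 0 < β' := by linarith [angle_nonneg c₂ c₃]
  have hsum : β + β' < angle c₁ c₃ := by linarith
  have hpi : β + β' < Real.pi := hsum.trans_le (angle_le_pi _ _)
  obtain ⟨δ, hδ, h12⟩ := exists_bound c₁ c₂ (β := β) (by linarith)
  obtain ⟨δ', hδ', h23⟩ := exists_bound c₂ c₃ (β := β') (by linarith)
  have hfr := frequently_lt_of_lt_limsup (isCoboundedUnder c₁ c₃ _) hsum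
  have v1 := c₁.speed_pos
  have v2 := c₂.speed_pos
  have v3 := c₃.speed_pos
  set r := min (min δ δ') c₂.len with hr
  have hr0 : 0 < r := lt_min (lt_min hδ hδ') c₂.isGeodesic.pos
  have ev1 : ∀ᶠ s in 𝓝[>] (0 : ℝ), s ∈ Ioo 0 (min δ (c₂.speed * r / c₁.speed)) :=
    Ioo_mem_nhdsGT (lt_min hδ (by positivity))
  have ev3 : ∀ᶠ s in 𝓝[>] (0 : ℝ), s ∈ Ioo 0 (min δ' (c₂.speed * r / c₃.speed)) :=
    Ioo_mem_nhdsGT (lt_min hδ' (by positivity))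
  obtain ⟨⟨s, t⟩, hz, ⟨hs, hs'⟩, ht, ht'⟩ := (hfr.and_eventually
    ((c₁.eventually_mem.and ev1).prod_mk (c₃.eventually_mem.and ev3))).exists
  dsimp only at hs hs' ht ht'
  obtain ⟨q, hq0, hqle, hq⟩ := exists_split (mul_pos v1 hs.1) (mul_pos v3 ht.1) b0 b0' hpi
  have hs2 : c₁.speed * s < c₂.speed * r := by
    have := hs'.2.trans_le (min_le_right _ _)
    rwa [lt_div_iff₀ v1, mul_comm] at this
  have ht2 : c₃.speed * t < c₂.speed * r := by
    have := ht'.2.trans_le (min_le_right _ _)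
    rwa [lt_div_iff₀ v3, mul_comm] at this
  have hqr : q / c₂.speed < r := by
    rw [div_lt_iff₀ v2, mul_comm]
    exact hqle.trans_lt (max_lt hs2 ht2)
  have hq1 : 0 < q / c₂.speed := by positivity
  have hqm : q / c₂.speed ∈ Ioo 0 c₂.len := ⟨hq1, hqr.trans_le (min_le_right _ _)⟩
  have hqd : c₂.speed * (q / c₂.speed) = q := by field_simp
  have m12 := h12 s ⟨hs.1, hs'.2.trans_le (min_le_left _ _)⟩ (q / c₂.speed)
    ⟨hq1, hqr.trans_le ((min_le_left _ _).trans (min_le_left _ _))⟩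
  have m23 := h23 (q / c₂.speed) ⟨hq1, hqr.trans_le ((min_le_left _ _).trans (min_le_right _ _))⟩
    t ⟨ht.1, ht'.2.trans_le (min_le_left _ _)⟩
  rw [angleAt] at m12 m23 hz
  dsimp only at m12 m23 hz
  rw [c₁.dist_source hs, c₂.dist_source hqm, hqd] at m12
  rw [c₂.dist_source hqm, hqd, c₃.dist_source ht] at m23
  rw [c₁.dist_source hs, c₃.dist_source ht] at hz
  have n12 := lt_sqrt_of_comparisonAngle_lt (mul_pos v1 hs.1) hq0 b0.le
    (by linarith) m12
  have n23 := lt_sqrt_of_comparisonAngle_lt hq0 (mul_pos v3 ht.1) b0'.le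
    (by linarith) m23
  have n13 := sqrt_lt_of_lt_comparisonAngle (mul_pos v1 hs.1) (mul_pos v3 ht.1) dist_nonneg
    (by linarith) hpi.le hz
  have := dist_triangle (c₁.toFun s) (c₂.toFun (q / c₂.speed)) (c₃.toFun t)
  linarith

/-- The angle is a pseudo-distance on the set of nontrivial geodesics starting from `p`. -/
instance : PseudoMetricSpace (NontrivialGeodesic p) where
  dist := angle
  dist_self := angle_self
  dist_comm := angle_comm
  dist_triangle := angle_triangle

end NontrivialGeodesic

/-- The space of directions at `p`: the completion of the set of nontrivial geodesics starting from
`p` modulo the relation of having angle zero, with the distance given by the angle. (Mathlib's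
`UniformSpace.Completion` is the Hausdorff completion, so that it takes the quotient as well.) -/
abbrev SpaceOfDirections {Y : Type*} [MetricSpace Y] (p : Y) : Type _ :=
  UniformSpace.Completion (NontrivialGeodesic p)

/-- The tangent cone at `p`, i.e. the cone over the space of directions: a point is either the cone
point, or a pair `(u, t)` of a direction `u` and a length `t > 0`. If there are no directions, the
cone consists of the cone point only. -/
inductive TangentCone {Y : Type*} [MetricSpace Y] (p : Y) : Type _
  | apex : TangentCone p
  | ray (u : SpaceOfDirections p) (t : ℝ) (ht : 0 < t) : TangentCone p

namespace TangentCone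

variable {Y : Type*} [MetricSpace Y] {p : Y}

/-- The length `|v|` of a point of the tangent cone. -/
def length : TangentCone p → ℝ
  | apex => 0
  | ray _ t _ => t

/-- The inner product of `(u,t)` and `(u',t')` is `t t' cos ∠(u,u')`. -/
def innerProduct : TangentCone p → TangentCone p → ℝ
  | ray u t _, ray u' t' _ => t * t' * Real.cos (dist u u')
  | _, _ => 0

/-- The cone distance, `d(v,v')² = |v|² + |v'|² - 2 ⟨v,v'⟩`. -/
instance : Dist (TangentCone p) where
  dist v w := √(v.length ^ 2 + w.length ^ 2 - 2 * innerProduct v w)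

open Classical in
/-- The natural projection `Y → TC_p Y`, which maps `q ≠ p` to `([c], d(p,q))`, where `c` is the
geodesic joining `p` to `q`, and `p` to the cone point. -/
def proj (p q : Y) : TangentCone p :=
  if h : ∃ c : NontrivialGeodesic p, c.endpoint = q then
    ray ((h.choose : NontrivialGeodesic p) : SpaceOfDirections p) (dist p q)
      (dist_pos.2 (h.choose_spec ▸ h.choose.nontrivial))
  else apex

/-- `b` is a barycenter of the finitely supported measure `∑ i, w i • δ_{v i}`: it minimizes
`q ↦ ∑ i, w i * d(v i, q)²`. -/
def IsBarycenter {ι : Type*} (w : ι → ℝ) (v : ι → TangentCone p) (b : TangentCone p) : Prop :=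
  ∀ q : TangentCone p, ∑ᶠ i, w i * dist (v i) b ^ 2 ≤ ∑ᶠ i, w i * dist (v i) q ^ 2

open Classical in
/-- The barycenter of the finitely supported measure `∑ i, w i • δ_{v i}` (the cone point, if there
were none). -/
def barycenter {ι : Type*} (w : ι → ℝ) (v : ι → TangentCone p) : TangentCone p :=
  if h : ∃ b, IsBarycenter w v b then h.choose else apex

end TangentCone

/-! ### Random walks, equivariant maps, and energies -/

/-- `μ` is (the transition function of) an invariant, finitely supported, symmetric and irreducible
random walk on the group `Γ`. -/
structure IsRandomWalk {Γ : Type*} [Group Γ] (μ : Γ → Γ → ℝ) : Prop where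
  nonneg : ∀ a b, 0 ≤ μ a b
  invariant : ∀ g a b, μ (g * a) (g * b) = μ a b
  finite_support : ∀ a, {b | μ a b ≠ 0}.Finite
  sum_eq_one : ∀ a, ∑ᶠ b, μ a b = 1
  symm : ∀ a b, μ a b = μ b a
  irreducible : ∀ a b, Relation.ReflTransGen (fun x y => μ x y ≠ 0) a b

open Classical in
/-- The `n`-th convolution power of `μ`. -/
def convPow {Γ : Type*} (μ : Γ → Γ → ℝ) : ℕ → Γ → Γ → ℝ
  | 0 => fun a b => if a = b then 1 else 0
  | n + 1 => fun a b => ∑ᶠ c, μ a c * convPow μ n c b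

/-- `f : Γ → Y` is `ρ`-equivariant. -/
def IsEquivariant {Γ Y : Type*} [Group Γ] [MetricSpace Y] (ρ : Γ →* (Y ≃ᵢ Y)) (f : Γ → Y) : Prop :=
  ∀ a b, f (a * b) = ρ a (f b)

/-- The energy `E_μ(f)`, computed at the identity element. -/
def energy {Γ Y : Type*} [Group Γ] [MetricSpace Y] (μ : Γ → Γ → ℝ) (f : Γ → Y) : ℝ :=
  1 / 2 * ∑ᶠ a, μ 1 a * dist (f 1) (f a) ^ 2

/-- `-Δ_μ f(e)`: the barycenter of the push-forward of `μ(e, ·)` to the tangent cone at `f(e)` by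
the map `γ ↦ π_{f(e)} (f(γ))`. -/
def negLaplacian {Γ Y : Type*} [Group Γ] [MetricSpace Y] (μ : Γ → Γ → ℝ) (f : Γ → Y) :
    TangentCone (f 1) :=
  TangentCone.barycenter (μ 1) fun a => TangentCone.proj (f 1) (f a)

end NStepEnergy

end

open NStepEnergy

/-! Both conclusions rest on one quantitative notion, `AlmostHarmonic μ f τ`. For a harmonic map
into a CAT(0) space, the mean of d(f(·), q)² after one step exceeds its current value by at least
2E(f); here a defect 2τ d(f(e), q) is allowed.

By equivariance the inequality holds at every group element, so it can be iterated with the Markov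
operator. The defects are controlled because the mean distance from f(e) after l steps is at most
l√(2E(f)). This gives 2E_{μ^l}(f) ≥ 2l E(f) - τ√(2E(f)) l² (`AlmostHarmonic.le_energy_convPow`).
Against the hypothesis E_{μ^l}(f) ≤ (l - ε)E(f) with l ≤ n, only 2ε²E(f) ≤ n⁴τ² survives
(`AlmostHarmonic.energy_le`). The two conclusions come from two sources of τ.

Laplacian: every equivariant f is almost harmonic with τ = |-Δf(e)|
(`almostHarmonic_length_negLaplacian`). The length of a barycenter bounds the mean inner product
with every direction (`IsBarycenter.meanPairing_le`), and the projection to the tangent cone does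
not increase distances, so inner products there dominate their comparison values in Y. The
barycenter exists (`exists_isBarycenter`) because almost maximizing directions form a Cauchy
sequence; the midpoints that show this are taken in Y at small scale, so no geodesics of the cone
itself are needed.

Fixed point: Ekeland's principle, applied to √E on the orbit maps, yields p with √E(p) ≤ √E(q) + κ
d(p, q) for all q. Convexity of the energy along geodesics makes the orbit map of p almost harmonic
with τ = κ√E(p) (`almostHarmonic_of_almost_minimizer`). For κ = ε/n² this forces E(p) = 0, and
irreducibility makes p a global fixed point. This half does not pass through the Laplacian estimate.
-/

noncomputable section

namespace NStepEnergy

/-! ### Comparison in `CAT(0)` spaces -/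

section CAT0

variable {Y : Type*} [MetricSpace Y]

/-- Every triple of points of a metric space has a comparison triangle in the Euclidean plane. -/
lemma exists_comparison_triangle (p : Fin 3 → Y) :
    ∃ x : Fin 3 → EuclideanSpace ℝ (Fin 2), ∀ i j, dist (x i) (x j) = dist (p i) (p j) := by
  set A := dist (p 0) (p 1) with hA
  set B := dist (p 0) (p 2) with hB
  set D := dist (p 1) (p 2) with hD
  have hA0 : 0 ≤ A := dist_nonneg
  have hB0 : 0 ≤ B := dist_nonneg
  have hD0 : 0 ≤ D := dist_nonneg
  have t1 : A ≤ B + D := by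
    have := dist_triangle (p 0) (p 2) (p 1); rwa [dist_comm (p 2) (p 1)] at this
  have t2 : B ≤ A + D := dist_triangle _ _ _
  have t3 : D ≤ A + B := by
    have := dist_triangle (p 1) (p 0) (p 2); rwa [dist_comm (p 1) (p 0)] at this
  -- The abscissa of the third vertex, by the law of cosines. If A = 0, division by zero gives u =
  -- 0, which is still correct because then B = D.
  set u := (A ^ 2 + B ^ 2 - D ^ 2) / (2 * A) with hu
  have hAu : 2 * (A * u) = A ^ 2 + B ^ 2 - D ^ 2 := by
    rcases hA0.eq_or_lt with h | h
    · have : B = D := by linarith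
      rw [← h, this]; ring
    · rw [hu]; field_simp
  have huB : u ^ 2 ≤ B ^ 2 := by
    rcases hA0.eq_or_lt with h | h
    · rw [hu, ← h]; simp; positivity
    · have : (A * u) ^ 2 ≤ (A * B) ^ 2 := by
        apply sq_le_sq'
        · nlinarith
        · nlinarith
      rw [mul_pow, mul_pow] at this
      exact le_of_mul_le_mul_left this (by positivity)
  have hv : √(B ^ 2 - u ^ 2) ^ 2 = B ^ 2 - u ^ 2 := Real.sq_sqrt (by linarith)
  set v := √(B ^ 2 - u ^ 2) with hv'
  let x : Fin 3 → EuclideanSpace ℝ (Fin 2) := ![!₂[0, 0], !₂[A, 0], !₂[u, v]]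
  have d01 : dist (x 0) (x 1) = A := by
    simp [x, EuclideanSpace.dist_eq, Real.dist_eq, Real.sqrt_sq hA0]
  have d02 : dist (x 0) (x 2) = B := by
    simp only [x, EuclideanSpace.dist_eq, Real.dist_eq, Fin.sum_univ_two, sq_abs]
    simp [hv, Real.sqrt_sq hB0]
  have d12 : dist (x 1) (x 2) = D := by
    simp only [x, EuclideanSpace.dist_eq, Real.dist_eq, Fin.sum_univ_two, sq_abs]
    simp only [Matrix.cons_val]
    rw [show (A - u) ^ 2 + (0 - v) ^ 2 = D ^ 2 by linear_combination hv - hAu, Real.sqrt_sq hD0]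
  refine ⟨x, fun i j => ?_⟩
  fin_cases i <;> fin_cases j <;> simp only [Fin.zero_eta, Fin.mk_one, Fin.reduceFinMk, dist_self]
  · exact d01
  · exact d02
  · rw [dist_comm, d01, hA, dist_comm]
  · exact d12
  · rw [dist_comm, d02, hB, dist_comm]
  · rw [dist_comm, d12, hD, dist_comm]

lemma IsGeodesic.reverse {c : ℝ → Y} {p q : Y} (h : IsGeodesic c 1 p q) :
    IsGeodesic (fun t => c (1 - t)) 1 q p where
  pos := one_pos
  source := by simp [h.target]
  target := by simp [h.source]
  dist_eq s hs t ht := by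
    rw [h.dist_eq (1 - s) ⟨by linarith [hs.2], by linarith [hs.1]⟩ (1 - t)
      ⟨by linarith [ht.2], by linarith [ht.1]⟩, dist_comm p q,
      show 1 - s - (1 - t) = -(s - t) by ring, abs_neg]

/-- An initial piece of a geodesic, reparametrized on `[0,1]`. -/
lemma IsGeodesic.initial {c : ℝ → Y} {p q : Y} {l s : ℝ} (h : IsGeodesic c l p q)
    (hs : s ∈ Icc 0 l) : IsGeodesic (fun t => c (t * s)) 1 p (c s) where
  pos := one_pos
  source := by simp [h.source]
  target := by simp
  dist_eq a ha b hb := by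
    have hl := h.pos
    have e : dist p (c s) = s * dist p q / l := by
      have := h.dist_eq 0 ⟨le_rfl, hl.le⟩ s hs
      rwa [h.source, zero_sub, abs_neg, abs_of_nonneg hs.1] at this
    have hm : ∀ a ∈ Icc (0 : ℝ) 1, a * s ∈ Icc 0 l := fun a ha =>
      ⟨mul_nonneg ha.1 hs.1, (mul_le_of_le_one_left hs.1 ha.2).trans hs.2⟩
    rw [h.dist_eq _ (hm a ha) _ (hm b hb), e, ← sub_mul, abs_mul, abs_of_nonneg hs.1]
    ring

/-- Comparison for two sides of a triangle issuing from the same vertex. -/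
lemma IsCAT0.dist_sq_le (hY : IsCAT0 Y) {p q r : Y} {c c' : ℝ → Y} (hc : IsGeodesic c 1 p q)
    (hc' : IsGeodesic c' 1 p r) {a b : ℝ} (ha : a ∈ Icc (0 : ℝ) 1) (hb : b ∈ Icc (0 : ℝ) 1) :
    dist (c a) (c' b) ^ 2 ≤ a ^ 2 * dist p q ^ 2 + b ^ 2 * dist p r ^ 2 -
      a * b * (dist p q ^ 2 + dist p r ^ 2 - dist q r ^ 2) := by
  obtain ⟨e, he⟩ := hY.exists_geodesic q r
  obtain ⟨x, hx⟩ := exists_comparison_triangle ![p, q, r]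
  -- The sides of a triangle are oriented cyclically, so the side from r to p is `c'` reversed, with
  -- parameter 1 - b.
  have key := hY.comparison ![p, q, r] ![c, e, fun t => c' (1 - t)] x
    (by
      intro i
      fin_cases i
      · exact hc
      · exact he
      · exact hc'.reverse) hx 0 2 a ha (1 - b) ⟨by linarith [hb.2], by linarith [hb.1]⟩
  have h01 := hx 0 1
  have h02 := hx 0 2
  have h12 := hx 1 2
  simp only [Matrix.cons_val] at h01 h02 h12 key
  rw [sub_sub_cancel] at key
  have k2 := pow_le_pow_left₀ dist_nonneg key 2
  refine k2.trans_eq ?_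
  rw [← h01, ← h02, ← h12]
  rw [dist_eq_norm, dist_comm (x 0), dist_comm (x 0), dist_eq_norm (x 1), dist_eq_norm (x 2),
    dist_eq_norm (x 1)]
  have e1 : (AffineMap.lineMap (x 0) (x (0 + 1)) a : EuclideanSpace ℝ (Fin 2)) -
      AffineMap.lineMap (x 2) (x (2 + 1)) (1 - b) = a • (x 1 - x 0) - b • (x 2 - x 0) := by
    rw [show (2 + 1 : Fin 3) = 0 from rfl, show (0 + 1 : Fin 3) = 1 from rfl,
      AffineMap.lineMap_apply_module, AffineMap.lineMap_apply_module]
    module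
  rw [e1, show x 1 - x 2 = (x 1 - x 0) - (x 2 - x 0) by abel, norm_sub_sq_real (a • _),
    norm_sub_sq_real (x 1 - x 0), norm_smul, norm_smul, inner_smul_left, inner_smul_right, mul_pow, mul_pow, Real.norm_eq_abs,
    Real.norm_eq_abs, sq_abs, sq_abs]
  simp only [conj_trivial]
  ring

/-- Comparison for the distance from a point to a point of a geodesic. -/
lemma IsCAT0.dist_sq_le_of_point (hY : IsCAT0 Y) {p q : Y} {c : ℝ → Y} (hc : IsGeodesic c 1 p q)
    (r : Y) {a : ℝ} (ha : a ∈ Icc (0 : ℝ) 1) :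
    dist (c a) r ^ 2 ≤ (1 - a) * dist p r ^ 2 + a * dist q r ^ 2 -
      a * (1 - a) * dist p q ^ 2 := by
  obtain ⟨e, he⟩ := hY.exists_geodesic p r
  have := hY.dist_sq_le hc he ha (b := 1) ⟨zero_le_one, le_rfl⟩
  rw [he.target] at this
  linarith

end CAT0

/-! ### The Markov operator of a random walk -/

section RandomWalk

variable {Γ : Type*} [Group Γ] {μ : Γ → Γ → ℝ}

namespace IsRandomWalk

/-- The steps of the random walk. -/
def steps (hμ : IsRandomWalk μ) : Finset Γ := (hμ.finite_support 1).toFinset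

lemma finsum_step (hμ : IsRandomWalk μ) (h : Γ → ℝ) :
    ∑ᶠ b, μ 1 b * h b = ∑ s ∈ hμ.steps, μ 1 s * h s := by
  apply finsum_eq_sum_of_support_subset
  intro b hb
  simp only [steps, Finite.coe_toFinset, mem_ofPred_eq]
  exact left_ne_zero_of_mul hb

lemma sum_steps (hμ : IsRandomWalk μ) : ∑ s ∈ hμ.steps, μ 1 s = 1 := by
  have := hμ.finsum_step fun _ => 1
  simpa [hμ.sum_eq_one] using this.symm

/-- The Markov operator: `averaging h a` is the mean of `h` after one step from `a`. -/
def averaging (hμ : IsRandomWalk μ) (h : Γ → ℝ) : Γ → ℝ :=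
  fun a => ∑ s ∈ hμ.steps, μ 1 s * h (a * s)

lemma finsum_eq_averaging (hμ : IsRandomWalk μ) (h : Γ → ℝ) (a : Γ) :
    ∑ᶠ b, μ a b * h b = hμ.averaging h a := by
  rw [averaging, ← hμ.finsum_step fun s => h (a * s)]
  rw [← finsum_comp_equiv (Equiv.mulLeft a)]
  refine finsum_congr fun s => ?_
  have := hμ.invariant a 1 s
  rw [mul_one] at this
  simp [this]

lemma averaging_mono (hμ : IsRandomWalk μ) : Monotone hμ.averaging := fun _ _ h a =>
  Finset.sum_le_sum fun s _ => mul_le_mul_of_nonneg_left (h (a * s)) (hμ.nonneg _ _)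

lemma averaging_add (hμ : IsRandomWalk μ) (g h : Γ → ℝ) :
    hμ.averaging (g + h) = hμ.averaging g + hμ.averaging h := by
  funext a
  simp [averaging, mul_add, Finset.sum_add_distrib]

lemma averaging_smul (hμ : IsRandomWalk μ) (r : ℝ) (h : Γ → ℝ) :
    hμ.averaging (r • h) = r • hμ.averaging h := by
  funext a
  simp only [averaging, Pi.smul_apply, smul_eq_mul, Finset.mul_sum]
  exact Finset.sum_congr rfl fun s _ => by ring

lemma averaging_const (hμ : IsRandomWalk μ) (r : ℝ) :
    hμ.averaging (fun _ => r) = fun _ => r := by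
  funext a
  rw [averaging, ← Finset.sum_mul, hμ.sum_steps, one_mul]

lemma iterate_averaging_add (hμ : IsRandomWalk μ) (l : ℕ) (g h : Γ → ℝ) :
    hμ.averaging^[l] (g + h) = hμ.averaging^[l] g + hμ.averaging^[l] h := by
  induction l generalizing g h with
  | zero => rfl
  | succ l ih => simp only [Function.iterate_succ_apply, averaging_add, ih]

lemma iterate_averaging_smul (hμ : IsRandomWalk μ) (l : ℕ) (r : ℝ) (h : Γ → ℝ) :
    hμ.averaging^[l] (r • h) = r • hμ.averaging^[l] h := by
  induction l generalizing h with
  | zero => rfl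
  | succ l ih => simp only [Function.iterate_succ_apply, averaging_smul, ih]

lemma iterate_averaging_const (hμ : IsRandomWalk μ) (l : ℕ) (r : ℝ) :
    hμ.averaging^[l] (fun _ => r) = fun _ => r := by
  induction l with
  | zero => rfl
  | succ l ih => rw [Function.iterate_succ_apply, averaging_const, ih]

lemma convPow_succ_eq (hμ : IsRandomWalk μ) (l : ℕ) (a b : Γ) :
    convPow μ (l + 1) a b = ∑ s ∈ hμ.steps, μ 1 s * convPow μ l (a * s) b :=
  hμ.finsum_eq_averaging (fun c => convPow μ l c b) a

lemma finite_support_convPow (hμ : IsRandomWalk μ) (l : ℕ) (a : Γ) :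
    (Function.support (convPow μ l a)).Finite := by
  induction l generalizing a with
  | zero =>
    refine (finite_singleton a).subset fun b hb => ?_
    by_contra hne
    exact hb (by simp [convPow, Ne.symm hne])
  | succ l ih =>
    refine (hμ.steps.finite_toSet.biUnion fun s _ => ih (a * s)).subset fun b hb => ?_
    rw [Function.mem_support, convPow_succ_eq hμ] at hb
    obtain ⟨s, hs, hne⟩ := Finset.exists_ne_zero_of_sum_ne_zero hb
    exact mem_biUnion hs (right_ne_zero_of_mul hne)

/-- The mean after `l` steps is given by the `l`-th power of the Markov operator. -/
lemma finsum_convPow (hμ : IsRandomWalk μ) (l : ℕ) (h : Γ → ℝ) (a : Γ) :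
    ∑ᶠ b, convPow μ l a b * h b = hμ.averaging^[l] h a := by
  induction l generalizing a with
  | zero =>
    rw [finsum_eq_single _ a fun b hb => by simp [convPow, hb.symm]]
    simp [convPow]
  | succ l ih =>
    rw [Function.iterate_succ_apply', averaging]
    simp_rw [convPow_succ_eq hμ, Finset.sum_mul, mul_assoc, ← ih]
    rw [finsum_sum_comm]
    · refine Finset.sum_congr rfl fun s _ => ?_
      rw [mul_finsum]
    · intro s _
      exact (hμ.finite_support_convPow l (a * s)).subset fun b hb =>
        left_ne_zero_of_mul (right_ne_zero_of_mul hb)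

end IsRandomWalk

/-! ### Almost harmonic maps and the growth of the l-step energy. -/

variable {Y : Type*} [MetricSpace Y] {ρ : Γ →* (Y ≃ᵢ Y)} {f : Γ → Y}

lemma energy_nonneg (hμ : IsRandomWalk μ) (f : Γ → Y) : 0 ≤ energy μ f :=
  mul_nonneg (by norm_num) (finsum_nonneg fun a => mul_nonneg (hμ.nonneg _ _) (sq_nonneg _))

lemma two_mul_energy (hμ : IsRandomWalk μ) (f : Γ → Y) :
    2 * energy μ f = ∑ s ∈ hμ.steps, μ 1 s * dist (f 1) (f s) ^ 2 := by
  rw [energy, hμ.finsum_step]; ring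

lemma two_mul_energy_convPow (hμ : IsRandomWalk μ) (l : ℕ) (f : Γ → Y) :
    2 * energy (convPow μ l) f = hμ.averaging^[l] (fun a => dist (f a) (f 1) ^ 2) 1 := by
  rw [energy, ← hμ.finsum_convPow]
  simp_rw [dist_comm (f 1)]; ring

lemma IsEquivariant.dist_mul (hf : IsEquivariant ρ f) (a b c : Γ) :
    dist (f (a * b)) (f (a * c)) = dist (f b) (f c) := by
  rw [hf, hf, (ρ a).dist_eq]

/-- `f` is `τ`-almost harmonic at `e`: the mean of the squared distance to any point grows, up to
the error term, as for a harmonic map. -/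
def AlmostHarmonic (μ : Γ → Γ → ℝ) (f : Γ → Y) (τ : ℝ) : Prop :=
  ∀ q : Y, 2 * energy μ f + dist (f 1) q ^ 2 - 2 * τ * dist (f 1) q ≤
    ∑ᶠ s, μ 1 s * dist (f s) q ^ 2

/-- The isometry ρ(a) carries the condition at e, tested against ρ(a)⁻¹q, to a condition at a tested
against q. This is what makes iteration possible. -/
lemma AlmostHarmonic.le_averaging (hμ : IsRandomWalk μ) (hf : IsEquivariant ρ f) {τ : ℝ}
    (h : AlmostHarmonic μ f τ) (q : Y) (a : Γ) :
    2 * energy μ f + dist (f a) q ^ 2 - 2 * τ * dist (f a) q ≤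
      hμ.averaging (fun b => dist (f b) q ^ 2) a := by
  have key : ∀ b, dist (f b) ((ρ a).symm q) = dist (f (a * b)) q := fun b => by
    rw [hf a b, ← (ρ a).dist_eq, (ρ a).apply_symm_apply]
  have := h ((ρ a).symm q)
  rw [hμ.finsum_step] at this
  simpa only [key, mul_one, IsRandomWalk.averaging] using this

/-- By Cauchy–Schwarz the mean displacement of f in one step is at most √(2E), from any starting
point by equivariance. -/
lemma averaging_dist_le (hμ : IsRandomWalk μ) (hf : IsEquivariant ρ f) (q : Y) (a : Γ) :
    hμ.averaging (fun b => dist (f b) q) a ≤ dist (f a) q + √(2 * energy μ f) := by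
  have h1 : ∑ s ∈ hμ.steps, μ 1 s * dist (f 1) (f s) ≤ √(2 * energy μ f) := by
    apply Real.le_sqrt_of_sq_le
    rw [two_mul_energy hμ]
    have := Finset.sum_mul_sq_le_sq_mul_sq hμ.steps (fun s => √(μ 1 s))
      (fun s => √(μ 1 s) * dist (f 1) (f s))
    simp only [mul_pow, Real.sq_sqrt (hμ.nonneg _ _), ← mul_assoc,
      Real.mul_self_sqrt (hμ.nonneg _ _), hμ.sum_steps, one_mul] at this
    exact this
  calc hμ.averaging (fun b => dist (f b) q) a
      ≤ ∑ s ∈ hμ.steps, (μ 1 s * dist (f a) q + μ 1 s * dist (f 1) (f s)) := by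
        refine Finset.sum_le_sum fun s _ => ?_
        rw [← mul_add]
        refine mul_le_mul_of_nonneg_left ?_ (hμ.nonneg _ _)
        have e := hf.dist_mul a 1 s
        rw [mul_one] at e
        rw [← e, add_comm, dist_comm (f a) (f (a * s))]
        exact dist_triangle _ _ _
    _ ≤ _ := by
        rw [Finset.sum_add_distrib, ← Finset.sum_mul, hμ.sum_steps, one_mul]
        linarith

lemma iterate_averaging_dist_le (hμ : IsRandomWalk μ) (hf : IsEquivariant ρ f) (q : Y) (l : ℕ)
    (a : Γ) :
    hμ.averaging^[l] (fun b => dist (f b) q) a ≤ dist (f a) q + l * √(2 * energy μ f) := by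
  induction l generalizing a with
  | zero => simp
  | succ l ih =>
    rw [Function.iterate_succ_apply']
    refine (hμ.averaging_mono (fun b => ih b) a).trans ?_
    have e : (fun b => dist (f b) q + l * √(2 * energy μ f)) =
      (fun b => dist (f b) q) + fun _ => l * √(2 * energy μ f) := rfl
    rw [e, hμ.averaging_add, hμ.averaging_const, Pi.add_apply]
    have := averaging_dist_le hμ hf q a
    push_cast
    linarith

/-- The `l`-step energy of an almost harmonic map is at least `l` times its energy, up to an
error term. -/
lemma AlmostHarmonic.le_energy_convPow (hμ : IsRandomWalk μ) (hf : IsEquivariant ρ f) {τ : ℝ}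
    (hτ : 0 ≤ τ) (h : AlmostHarmonic μ f τ) (l : ℕ) :
    2 * l * energy μ f - τ * √(2 * energy μ f) * l ^ 2 ≤ 2 * energy (convPow μ l) f := by
  rw [two_mul_energy_convPow hμ]
  induction l with
  | zero => simp
  | succ l ih =>
    rw [Function.iterate_succ_apply]
    have h1 : ((fun _ => 2 * energy μ f) + ((fun a => dist (f a) (f 1) ^ 2) +
        (-2 * τ) • fun a => dist (f a) (f 1)) : Γ → ℝ) ≤
        hμ.averaging fun a => dist (f a) (f 1) ^ 2 := fun a => by
      have := h.le_averaging hμ hf (f 1) a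
      simp only [Pi.add_apply, Pi.smul_apply, smul_eq_mul]
      linarith
    refine le_trans ?_ (hμ.averaging_mono.iterate l h1 1)
    rw [hμ.iterate_averaging_add, hμ.iterate_averaging_add, hμ.iterate_averaging_smul,
      hμ.iterate_averaging_const]
    simp only [Pi.add_apply, Pi.smul_apply, smul_eq_mul]
    -- The new defect is at most 2τ l√(2E), which fits into the increment (l+1)² - l² = 2l + 1 of
    -- the error term.
    have h2 := mul_le_mul_of_nonneg_left (iterate_averaging_dist_le hμ hf (f 1) l 1) hτ
    rw [dist_self, zero_add] at h2
    have h3 := mul_nonneg hτ (Real.sqrt_nonneg (2 * energy μ f))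
    push_cast
    nlinarith

/-- If some `l`-step energy is smaller than that of a harmonic map, then an almost harmonic map
has small energy. -/
lemma AlmostHarmonic.energy_le (hμ : IsRandomWalk μ) (hf : IsEquivariant ρ f) {τ : ℝ}
    (hτ : 0 ≤ τ) (h : AlmostHarmonic μ f τ) {n l : ℕ} (hln : l ≤ n) {ε : ℝ} (hε : 0 < ε)
    (hl : energy (convPow μ l) f ≤ ((l : ℝ) - ε) * energy μ f) :
    2 * ε ^ 2 * energy μ f ≤ (n : ℝ) ^ 4 * τ ^ 2 := by
  have h1 := h.le_energy_convPow hμ hf hτ l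
  have hE := energy_nonneg hμ f
  have hs := Real.sq_sqrt (show 0 ≤ 2 * energy μ f by linarith)
  have hs0 := Real.sqrt_nonneg (2 * energy μ f)
  set r := √(2 * energy μ f)
  have hnl : (l : ℝ) ^ 2 ≤ (n : ℝ) ^ 2 := by gcongr
  have h2 : ε * r ^ 2 ≤ τ * r * n ^ 2 := by
    have := mul_le_mul_of_nonneg_left hnl (mul_nonneg hτ hs0)
    nlinarith
  have h3 : ε * r ≤ n ^ 2 * τ := by
    rcases hs0.eq_or_lt with h0 | h0
    · rw [← h0, mul_zero]; positivity
    · refine le_of_mul_le_mul_right ?_ h0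
      nlinarith
  have := pow_le_pow_left₀ (by positivity) h3 2
  nlinarith

end RandomWalk

/-! ### Almost minimizers of the energy and fixed points -/

/-- A form of Ekeland's variational principle. -/
lemma exists_forall_le_add_mul_dist {Y : Type*} [MetricSpace Y] [CompleteSpace Y] [Nonempty Y]
    {G : Y → ℝ} (hG : Continuous G) (h0 : ∀ x, 0 ≤ G x) {κ : ℝ} (hκ : 0 < κ) :
    ∃ p, ∀ q, G p ≤ G q + κ * dist p q := by
  -- The points that improve on x at rate at least κ. The sequence below picks almost minimizers of
  -- G in nested such sets, whose radii then shrink geometrically.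
  let S : Y → Set Y := fun x => {y | G y + κ * dist x y ≤ G x}
  have hself : ∀ x, x ∈ S x := fun x => by simp [S]
  have htrans : ∀ x y z, y ∈ S x → z ∈ S y → z ∈ S x := fun x y z hy hz => by
    have := mul_le_mul_of_nonneg_left (dist_triangle x y z) hκ.le
    change G y + κ * dist x y ≤ G x at hy
    change G z + κ * dist y z ≤ G y at hz
    change G z + κ * dist x z ≤ G x
    linarith
  have hclosed : ∀ x, IsClosed (S x) := fun x => isClosed_le (by fun_prop) (by fun_prop)
  have hnext : ∀ (k : ℕ) (x : Y), ∃ y ∈ S x, ∀ z ∈ S x, G y ≤ G z + (1 / 2) ^ k := by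
    intro k x
    have hne : (G '' S x).Nonempty := ⟨_, mem_image_of_mem G (hself x)⟩
    have hb : BddBelow (G '' S x) := ⟨0, by rintro _ ⟨y, -, rfl⟩; exact h0 y⟩
    obtain ⟨_, ⟨y, hy, rfl⟩, hlt⟩ := exists_lt_of_csInf_lt hne
      (lt_add_of_pos_right (sInf (G '' S x)) (show (0 : ℝ) < (1 / 2) ^ k by positivity))
    exact ⟨y, hy, fun z hz => by linarith [csInf_le hb (mem_image_of_mem G hz)]⟩
  choose next hmem hle using hnext
  let x : ℕ → Y := fun k => Nat.rec (Classical.arbitrary Y) (fun k y => next k y) k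
  let y : ℕ → Y := fun k => x (k + 1)
  have hy : ∀ k, y (k + 1) ∈ S (y k) := fun k => hmem (k + 1) (y k)
  have hdist : ∀ k, ∀ z ∈ S (y k), dist (y k) z ≤ 1 / κ * (1 / 2) ^ k := by
    intro k z hz
    have h1 : G (y k) ≤ G z + (1 / 2) ^ k := hle k (x k) z (htrans _ _ _ (hmem k (x k)) hz)
    have h2 : G z + κ * dist (y k) z ≤ G (y k) := hz
    rw [one_div_mul_eq_div, le_div_iff₀ hκ]
    linarith
  have hc : CauchySeq y := cauchySeq_of_le_geometric (1 / 2) (1 / κ) (by norm_num)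
    fun k => hdist k _ (hy k)
  obtain ⟨p, hp⟩ := cauchySeq_tendsto_of_complete hc
  have hanti : ∀ k j, k ≤ j → y j ∈ S (y k) := fun k j hkj => by
    induction j, hkj using Nat.le_induction with
    | base => exact hself _
    | succ j _ ih => exact htrans _ _ _ ih (hy j)
  have hpS : ∀ k, p ∈ S (y k) := fun k =>
    (hclosed _).mem_of_tendsto hp (eventually_atTop.2 ⟨k, fun j hj => hanti k j hj⟩)
  refine ⟨p, fun q => ?_⟩
  -- A violating q would lie in `S p`, hence in every `S (y k)`. Their shrinking radii force y → q,
  -- so q = p, which is absurd.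
  by_contra! hlt
  have hq : Tendsto y atTop (𝓝 q) := by
    rw [tendsto_iff_dist_tendsto_zero]
    refine squeeze_zero (fun _ => dist_nonneg)
      (fun k => hdist k q (htrans _ _ _ (hpS k) hlt.le)) ?_
    simpa using (tendsto_pow_atTop_nhds_zero_of_lt_one (r := (1 / 2 : ℝ)) (by norm_num)
      (by norm_num)).const_mul (1 / κ)
  rw [tendsto_nhds_unique hp hq] at hlt
  simp at hlt

/-- Replaces differentiation at 0: second-order terms are collected in K and vanish as s → 0. -/
lemma nonpos_of_forall_le_mul {X K : ℝ} (h : ∀ s ∈ Ioo (0 : ℝ) 1, X ≤ s * K) : X ≤ 0 := by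
  have ht : Tendsto (fun s : ℝ => s * K) (𝓝[>] 0) (𝓝 0) := by
    have : Tendsto (fun s : ℝ => s * K) (𝓝 0) (𝓝 (0 * K)) := tendsto_id.mul_const K
    rw [zero_mul] at this
    exact this.mono_left nhdsWithin_le_nhds
  exact ge_of_tendsto ht (by filter_upwards [Ioo_mem_nhdsGT one_pos] with s hs using h s hs)

section

variable {Γ : Type*} [Group Γ] {μ : Γ → Γ → ℝ} {Y : Type*} [MetricSpace Y]

/-- The `ρ`-equivariant map with value `p` at the identity element. -/
def orbitMap (ρ : Γ →* (Y ≃ᵢ Y)) (p : Y) : Γ → Y := fun a => ρ a p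

lemma isEquivariant_orbitMap (ρ : Γ →* (Y ≃ᵢ Y)) (p : Y) : IsEquivariant ρ (orbitMap ρ p) :=
  fun a b => by simp [orbitMap]

lemma orbitMap_one (ρ : Γ →* (Y ≃ᵢ Y)) (p : Y) : orbitMap ρ p 1 = p := by simp [orbitMap]

lemma continuous_energy_orbitMap (hμ : IsRandomWalk μ) (ρ : Γ →* (Y ≃ᵢ Y)) :
    Continuous fun p => energy μ (orbitMap ρ p) := by
  have h : (fun p => energy μ (orbitMap ρ p)) = fun p =>
      1 / 2 * ∑ s ∈ hμ.steps, μ 1 s * dist p (ρ s p) ^ 2 := by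
    funext p
    rw [energy, hμ.finsum_step]
    simp only [orbitMap_one]
    rfl
  rw [h]
  have hc : ∀ s, Continuous (ρ s) := fun s => (ρ s).continuous
  fun_prop

/-- Convexity of the energy along the orbits of the points of a geodesic. -/
lemma energy_geodesic_le (hY : IsCAT0 Y) (hμ : IsRandomWalk μ) (ρ : Γ →* (Y ≃ᵢ Y)) {p q : Y}
    {c : ℝ → Y} (hc : IsGeodesic c 1 p q) {s : ℝ} (hs : s ∈ Icc (0 : ℝ) 1) :
    2 * energy μ (orbitMap ρ (c s)) ≤ (1 - s) ^ 2 * (2 * energy μ (orbitMap ρ p)) +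
      2 * (s * (1 - s)) * ∑ᶠ a, μ 1 a * dist (ρ a p) q ^ 2 +
      s ^ 2 * (2 * energy μ (orbitMap ρ q)) - 2 * (s * (1 - s)) * dist p q ^ 2 := by
  -- Substituting a⁻¹ for a and using the symmetry of μ identifies the two mixed sums.
  have hsymm : ∑ᶠ a, μ 1 a * dist p (ρ a q) ^ 2 = ∑ᶠ a, μ 1 a * dist (ρ a p) q ^ 2 := by
    rw [← finsum_comp_equiv (Equiv.inv Γ)]
    refine finsum_congr fun a => ?_
    have h1 := hμ.invariant a 1 a⁻¹
    rw [mul_one, mul_inv_cancel, hμ.symm] at h1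
    rw [Equiv.inv_apply, ← h1, ← (ρ a).dist_eq p, ← IsometryEquiv.mul_apply, ← map_mul,
      mul_inv_cancel, map_one]
    rfl
  have hpt : ∀ a, dist (c s) (ρ a (c s)) ^ 2 ≤ (1 - s) ^ 2 * dist p (ρ a p) ^ 2 +
      s * (1 - s) * (dist p (ρ a q) ^ 2 + dist (ρ a p) q ^ 2) + s ^ 2 * dist q (ρ a q) ^ 2 -
      2 * (s * (1 - s)) * dist p q ^ 2 := by
    intro a
    have hca : IsGeodesic (fun t => ρ a (c t)) 1 (ρ a p) (ρ a q) :=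
      ⟨one_pos, by rw [hc.source], by rw [hc.target], fun s hs t ht => by
        rw [(ρ a).dist_eq, (ρ a).dist_eq, hc.dist_eq s hs t ht]⟩
    -- Comparison is applied once in each variable: `h1` moves the first point along c, then `h2`
    -- and `h3` move the second along the translated geodesic.
    have h1 := hY.dist_sq_le_of_point hc (ρ a (c s)) hs
    have h2 := hY.dist_sq_le_of_point hca p hs
    have h3 := hY.dist_sq_le_of_point hca q hs
    rw [dist_comm _ p, dist_comm _ p, dist_comm _ p, (ρ a).dist_eq] at h2
    rw [dist_comm _ q, dist_comm (ρ a q) q, (ρ a).dist_eq] at h3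
    have h2' := mul_le_mul_of_nonneg_left h2 (sub_nonneg.2 hs.2)
    have h3' := mul_le_mul_of_nonneg_left h3 hs.1
    linarith
  have hsum := Finset.sum_le_sum fun a (_ : a ∈ hμ.steps) =>
    mul_le_mul_of_nonneg_left (hpt a) (hμ.nonneg 1 a)
  have hexp : ∑ a ∈ hμ.steps, μ 1 a * ((1 - s) ^ 2 * dist p (ρ a p) ^ 2 +
      s * (1 - s) * (dist p (ρ a q) ^ 2 + dist (ρ a p) q ^ 2) + s ^ 2 * dist q (ρ a q) ^ 2 -
      2 * (s * (1 - s)) * dist p q ^ 2) =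
      (1 - s) ^ 2 * ∑ a ∈ hμ.steps, μ 1 a * dist p (ρ a p) ^ 2 +
      (s * (1 - s)) * ∑ a ∈ hμ.steps, μ 1 a * dist p (ρ a q) ^ 2 +
      (s * (1 - s)) * ∑ a ∈ hμ.steps, μ 1 a * dist (ρ a p) q ^ 2 +
      s ^ 2 * ∑ a ∈ hμ.steps, μ 1 a * dist q (ρ a q) ^ 2 -
      2 * (s * (1 - s)) * dist p q ^ 2 * ∑ a ∈ hμ.steps, μ 1 a := by
    simp only [Finset.mul_sum, ← Finset.sum_add_distrib, ← Finset.sum_sub_distrib]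
    exact Finset.sum_congr rfl fun a _ => by ring
  rw [hexp, hμ.sum_steps, ← hμ.finsum_step fun a => dist p (ρ a q) ^ 2, hsymm,
    hμ.finsum_step fun a => dist (ρ a p) q ^ 2] at hsum
  rw [two_mul_energy hμ, two_mul_energy hμ, two_mul_energy hμ,
    hμ.finsum_step fun a => dist (ρ a p) q ^ 2]
  simp only [orbitMap_one]
  simp only [orbitMap]
  linarith

/-- An almost minimizer of the square root of the energy is almost harmonic. -/
lemma almostHarmonic_of_almost_minimizer (hY : IsCAT0 Y) (hμ : IsRandomWalk μ)
    (ρ : Γ →* (Y ≃ᵢ Y)) {κ : ℝ} (hκ : 0 < κ) {p : Y}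
    (hp : ∀ q, √(energy μ (orbitMap ρ p)) ≤ √(energy μ (orbitMap ρ q)) + κ * dist p q) :
    AlmostHarmonic μ (orbitMap ρ p) (κ * √(energy μ (orbitMap ρ p))) := by
  intro q
  rw [orbitMap_one]
  obtain ⟨c, hc⟩ := hY.exists_geodesic p q
  change _ ≤ ∑ᶠ a, μ 1 a * dist (ρ a p) q ^ 2
  have key := fun s (hs : s ∈ Ioo (0 : ℝ) 1) =>
    energy_geodesic_le hY hμ ρ hc ⟨hs.1.le, hs.2.le⟩
  have hEp := Real.sq_sqrt (energy_nonneg hμ (orbitMap ρ p))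
  have hp0 := Real.sqrt_nonneg (energy μ (orbitMap ρ p))
  set A := ∑ᶠ a, μ 1 a * dist (ρ a p) q ^ 2
  set e := √(energy μ (orbitMap ρ p))
  set D := dist p q with hD
  have hD0 : 0 ≤ D := dist_nonneg
  rw [← hEp] at key ⊢
  suffices h : 2 * (2 * e ^ 2 + D ^ 2 - 2 * (κ * e) * D - A) ≤ 0 by linarith
  refine nonpos_of_forall_le_mul
    (K := 2 * e ^ 2 - 2 * A + 2 * energy μ (orbitMap ρ q) + 2 * D ^ 2) fun s hs => ?_
  have h1 := hp (c s)
  have h2 : dist p (c s) = s * D := by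
    have := hc.dist_eq 0 ⟨le_rfl, zero_le_one⟩ s ⟨hs.1.le, hs.2.le⟩
    rwa [hc.source, zero_sub, abs_neg, abs_of_pos hs.1, div_one] at this
  rw [h2] at h1
  have hEs := Real.sq_sqrt (energy_nonneg hμ (orbitMap ρ (c s)))
  have hs0 := Real.sqrt_nonneg (energy μ (orbitMap ρ (c s)))
  have h3 := key s hs
  rw [← hEs] at h3
  set e' := √(energy μ (orbitMap ρ (c s)))
  have hk : 0 ≤ κ * (s * D) := mul_nonneg hκ.le (mul_nonneg hs.1.le hD0)
  -- This squares e - κsD ≤ e'. If the left side is not positive, the claim holds because its own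
  -- left side is then nonpositive.
  have h4 : e ^ 2 - 2 * e * (κ * (s * D)) ≤ e' ^ 2 := by
    rcases le_total e (κ * (s * D)) with h | h
    · nlinarith
    · nlinarith
  refine le_of_mul_le_mul_left ?_ hs.1
  nlinarith

/-- A point whose orbit map has no energy is fixed. -/
lemma fixed_of_energy_eq_zero (hμ : IsRandomWalk μ) (ρ : Γ →* (Y ≃ᵢ Y)) {p : Y}
    (h : energy μ (orbitMap ρ p) = 0) (a : Γ) : ρ a p = p := by
  have h1 := two_mul_energy hμ (orbitMap ρ p)
  rw [h, mul_zero, eq_comm, Finset.sum_eq_zero_iff_of_nonneg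
    fun s _ => mul_nonneg (hμ.nonneg _ _) (sq_nonneg _)] at h1
  have hstep : ∀ s, μ 1 s ≠ 0 → ρ s p = p := fun s hs => by
    have := h1 s (by simpa [IsRandomWalk.steps] using hs)
    rw [orbitMap_one, mul_eq_zero, or_iff_right hs, sq_eq_zero_iff, dist_eq_zero] at this
    exact this.symm
  induction hμ.irreducible 1 a with
  | refl => simp
  | @tail b c _ hbc ih =>
    -- By invariance a step from b to c is a step of the walk from the identity to b⁻¹c, which fixes
    -- p.
    have h2 := hμ.invariant b 1 (b⁻¹ * c)
    rw [mul_one, mul_inv_cancel_left] at h2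
    have h3 := hstep (b⁻¹ * c) (h2 ▸ hbc)
    rw [← mul_inv_cancel_left b c, map_mul, IsometryEquiv.mul_apply, h3, ih]

end

/-! ### Angles in `CAT(0)` spaces -/

section Angle

variable {Y : Type*} [MetricSpace Y]

/-- The law of cosines. -/
lemma two_mul_cos_comparisonAngle {p x y : Y} (hx : p ≠ x) (hy : p ≠ y) :
    2 * dist p x * dist p y * Real.cos (comparisonAngle (dist p x) (dist p y) (dist x y)) =
      dist p x ^ 2 + dist p y ^ 2 - dist x y ^ 2 := by
  have hA : 0 < dist p x := dist_pos.2 hx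
  have hB : 0 < dist p y := dist_pos.2 hy
  have t1 := dist_triangle_left x y p
  have t2 := dist_triangle p x y
  have t3 := dist_triangle_right p x y
  have hD : 0 ≤ dist x y := dist_nonneg
  rw [comparisonAngle, Real.cos_arccos]
  · field_simp
  · rw [le_div_iff₀ (by positivity)]; nlinarith
  · rw [div_le_iff₀ (by positivity)]; nlinarith

namespace NontrivialGeodesic

variable {p : Y}

/-- The angle is at most the comparison angle. -/
lemma angle_le_angleAt (hY : IsCAT0 Y) (c c' : NontrivialGeodesic p) {s t : ℝ}
    (hs : s ∈ Ioc 0 c.len) (ht : t ∈ Ioc 0 c'.len) : angle c c' ≤ angleAt c c' (s, t) := by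
  have hA := c.isGeodesic.initial ⟨hs.1.le, hs.2⟩
  have hB := c'.isGeodesic.initial ⟨ht.1.le, ht.2⟩
  -- It suffices that comparison angles at smaller parameters do not exceed the one at (s, t). That
  -- monotonicity is hinge comparison with ratios s'/s and t'/t.
  refine limsup_le_of_le (isCoboundedUnder c c' _) ?_
  have es : ∀ᶠ a in 𝓝[>] (0 : ℝ), a ∈ Ioo 0 s := Ioo_mem_nhdsGT hs.1
  have et : ∀ᶠ a in 𝓝[>] (0 : ℝ), a ∈ Ioo 0 t := Ioo_mem_nhdsGT ht.1
  filter_upwards [es.prod_mk et] with ⟨s', t'⟩ ⟨hs', ht'⟩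
  dsimp only at hs' ht'
  have ha : s' / s ∈ Icc (0 : ℝ) 1 :=
    ⟨div_nonneg hs'.1.le hs.1.le, (div_le_one hs.1).2 hs'.2.le⟩
  have hb : t' / t ∈ Icc (0 : ℝ) 1 :=
    ⟨div_nonneg ht'.1.le ht.1.le, (div_le_one ht.1).2 ht'.2.le⟩
  have ha0 : 0 < s' / s := div_pos hs'.1 hs.1
  have hb0 : 0 < t' / t := div_pos ht'.1 ht.1
  have key := hY.dist_sq_le hA hB ha hb
  have es : s' / s * s = s' := div_mul_cancel₀ _ hs.1.ne'
  have et : t' / t * t = t' := div_mul_cancel₀ _ ht.1.ne'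
  rw [es, et] at key
  have dA : dist p (c.toFun s') = s' / s * dist p (c.toFun s) := by
    have := hA.dist_eq 0 ⟨le_rfl, zero_le_one⟩ _ ha
    rwa [zero_mul, c.isGeodesic.source, es, zero_sub, abs_neg, abs_of_pos ha0, div_one] at this
  have dB : dist p (c'.toFun t') = t' / t * dist p (c'.toFun t) := by
    have := hB.dist_eq 0 ⟨le_rfl, zero_le_one⟩ _ hb
    rwa [zero_mul, c'.isGeodesic.source, et, zero_sub, abs_neg, abs_of_pos hb0, div_one] at this
  have pA : 0 < dist p (c.toFun s') := by
    rw [c.dist_source ⟨hs'.1, hs'.2.trans_le hs.2⟩]; exact mul_pos c.speed_pos hs'.1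
  have pB : 0 < dist p (c'.toFun t') := by
    rw [c'.dist_source ⟨ht'.1, ht'.2.trans_le ht.2⟩]; exact mul_pos c'.speed_pos ht'.1
  rw [dA] at pA
  rw [dB] at pB
  have pA' := pos_of_mul_pos_right pA ha0.le
  have pB' := pos_of_mul_pos_right pB hb0.le
  rw [angleAt, angleAt, comparisonAngle, comparisonAngle]
  apply Real.antitone_arccos
  dsimp only
  rw [dA, dB]
  rw [div_le_div_iff₀ (by positivity) (by positivity)]
  have := mul_le_mul_of_nonneg_right key (mul_pos pA' pB').le
  nlinarith

lemma source_ne (c : NontrivialGeodesic p) {s : ℝ} (hs : s ∈ Ioc 0 c.len) :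
    p ≠ c.toFun s := by
  have h := c.isGeodesic.dist_eq 0 ⟨le_rfl, c.isGeodesic.pos.le⟩ s ⟨hs.1.le, hs.2⟩
  rw [c.isGeodesic.source, zero_sub, abs_neg, abs_of_pos hs.1] at h
  rw [← dist_pos, h]
  exact div_pos (mul_pos hs.1 (dist_pos.2 c.nontrivial)) c.isGeodesic.pos

/-- The first half of the comparison of a hinge with a Euclidean one. -/
lemma sub_dist_sq_le (hY : IsCAT0 Y) (c c' : NontrivialGeodesic p) {s t : ℝ}
    (hs : s ∈ Ioc 0 c.len) (ht : t ∈ Ioc 0 c'.len) :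
    dist p (c.toFun s) ^ 2 + dist p (c'.toFun t) ^ 2 - dist (c.toFun s) (c'.toFun t) ^ 2 ≤
      2 * dist p (c.toFun s) * dist p (c'.toFun t) * Real.cos (angle c c') := by
  rw [← two_mul_cos_comparisonAngle (c.source_ne hs) (c'.source_ne ht)]
  refine mul_le_mul_of_nonneg_left ?_ (by positivity)
  exact Real.cos_le_cos_of_nonneg_of_le_pi (angle_nonneg c c') (angleAt_le_pi c c' (s, t))
    (angle_le_angleAt hY c c' hs ht)

lemma len_mem (c : NontrivialGeodesic p) : c.len ∈ Ioc 0 c.len :=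
  ⟨c.isGeodesic.pos, le_rfl⟩

/-- The point at distance `s` from `p` on the geodesic, if `s` is small enough. -/
def point (c : NontrivialGeodesic p) (s : ℝ) : Y := c.toFun (s / c.speed)

lemma tendsto_div_speed (c : NontrivialGeodesic p) {k : ℝ} (hk : 0 < k) :
    Tendsto (fun s => k * s / c.speed) (𝓝[>] 0) (𝓝[>] 0) := by
  have hc := c.speed_pos
  refine tendsto_nhdsWithin_iff.2 ⟨?_, ?_⟩
  · have : Tendsto (fun s => k * s / c.speed) (𝓝 0) (𝓝 (k * 0 / c.speed)) :=
      Continuous.tendsto (by fun_prop) 0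
    rw [mul_zero, zero_div] at this
    exact this.mono_left nhdsWithin_le_nhds
  · filter_upwards [self_mem_nhdsWithin] with s hs
    exact div_pos (mul_pos hk hs) hc

lemma eventually_mem_Ioo (c : NontrivialGeodesic p) {k : ℝ} (hk : 0 < k) :
    ∀ᶠ s in 𝓝[>] (0 : ℝ), k * s / c.speed ∈ Ioo 0 c.len :=
  (c.tendsto_div_speed hk).eventually c.eventually_mem

lemma dist_point (c : NontrivialGeodesic p) {s : ℝ} (hs : s / c.speed ∈ Ioo 0 c.len) :
    dist p (c.point s) = s := by
  rw [point, c.dist_source hs, mul_div_cancel₀ _ c.speed_pos.ne']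

/-- The second half of the comparison of a hinge with a Euclidean one, for small hinges. -/
lemma eventually_dist_sq_le (c c' : NontrivialGeodesic p) {k k' η : ℝ} (hk : 0 < k) (hk' : 0 < k')
    (hη : 0 < η) : ∀ᶠ s in 𝓝[>] (0 : ℝ), dist (c.point (k * s)) (c'.point (k' * s)) ^ 2 ≤
      (k * s) ^ 2 + (k' * s) ^ 2 - 2 * (k * s) * (k' * s) * (Real.cos (angle c c') - η) := by
  have h1 := eventually_lt_of_limsup_lt (lt_add_of_pos_right (angle c c') hη)
    (isBoundedUnder c c' _)
  have h2 := ((c.tendsto_div_speed hk).prodMk (c'.tendsto_div_speed hk')).eventually h1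
  filter_upwards [h2, c.eventually_mem_Ioo hk, c'.eventually_mem_Ioo hk'] with s h3 hs hs'
  have e := two_mul_cos_comparisonAngle (c.source_ne ⟨hs.1, hs.2.le⟩)
    (c'.source_ne ⟨hs'.1, hs'.2.le⟩)
  change _ = dist p (c.point (k * s)) ^ 2 + dist p (c'.point (k' * s)) ^ 2 -
    dist (c.point (k * s)) (c'.point (k' * s)) ^ 2 at e
  change 2 * dist p (c.point (k * s)) * dist p (c'.point (k' * s)) *
    Real.cos (angleAt c c' (k * s / c.speed, k' * s / c'.speed)) = _ at e
  rw [c.dist_point hs, c'.dist_point hs'] at e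
  set α := angleAt c c' (k * s / c.speed, k' * s / c'.speed) with hα
  have hks : 0 ≤ k * s := by
    rw [← c.dist_point hs]; exact dist_nonneg
  have hks' : 0 ≤ k' * s := by
    rw [← c'.dist_point hs']; exact dist_nonneg
  -- The limit superior gives only α < ∠ + η; this is enough, since cosine is decreasing on [0, π]
  -- and 1-Lipschitz.
  have hcos : Real.cos (angle c c') - η ≤ Real.cos α := by
    rcases le_total α (angle c c') with h | h
    · have := Real.cos_le_cos_of_nonneg_of_le_pi (angleAt_nonneg c c' _) (angle_le_pi c c') h
      linarith
    · have := Real.abs_cos_sub_cos_le α (angle c c')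
      rw [abs_of_nonneg (sub_nonneg.2 h)] at this
      have h4 := (abs_le.1 this).1
      linarith
  have := mul_le_mul_of_nonneg_left hcos
    (show 0 ≤ 2 * (k * s) * (k' * s) from by positivity)
  linarith

end NontrivialGeodesic

end Angle

/-! ### Barycenters in the tangent cone -/

namespace TangentCone

variable {Y : Type*} [MetricSpace Y] {p : Y}

/-- The inner product of a point of the tangent cone with a direction. -/
def pairing : TangentCone p → SpaceOfDirections p → ℝ
  | apex, _ => 0
  | ray u t _, u' => t * Real.cos (dist u u')

lemma length_nonneg : ∀ v : TangentCone p, 0 ≤ v.length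
  | apex => le_rfl
  | ray _ _ ht => ht.le

lemma innerProduct_ray (v : TangentCone p) (u : SpaceOfDirections p) (t : ℝ) (ht : 0 < t) :
    innerProduct v (ray u t ht) = t * pairing v u := by
  cases v with
  | apex => simp [innerProduct, pairing]
  | ray u' t' _ => simp only [innerProduct, pairing]; ring

lemma innerProduct_apex (v : TangentCone p) : innerProduct v apex = 0 := by
  cases v <;> rfl

lemma continuous_pairing (v : TangentCone p) : Continuous (pairing v) := by
  cases v with
  | apex => exact continuous_const
  | ray u t _ =>
    change Continuous fun u' => t * Real.cos (dist u u')
    fun_prop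

lemma pairing_le_length (v : TangentCone p) (u : SpaceOfDirections p) :
    pairing v u ≤ v.length := by
  cases v with
  | apex => exact le_rfl
  | ray u' t ht => exact mul_le_of_le_one_right ht.le (Real.cos_le_one _)

lemma dist_apex_sq (v : TangentCone p) : dist v apex ^ 2 = v.length ^ 2 := by
  change √(v.length ^ 2 + (0 : ℝ) ^ 2 - 2 * innerProduct v apex) ^ 2 = _
  rw [innerProduct_apex, Real.sq_sqrt (by nlinarith [sq_nonneg v.length])]
  ring

lemma dist_ray_sq (v : TangentCone p) (u : SpaceOfDirections p) (t : ℝ) (ht : 0 < t) :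
    dist v (ray u t ht) ^ 2 = v.length ^ 2 + t ^ 2 - 2 * t * pairing v u := by
  change √(v.length ^ 2 + t ^ 2 - 2 * innerProduct v (ray u t ht)) ^ 2 = _
  have := mul_le_mul_of_nonneg_left (pairing_le_length v u) ht.le
  rw [innerProduct_ray, Real.sq_sqrt (by nlinarith [sq_nonneg (v.length - t)])]
  ring

lemma proj_self : proj p p = apex := by
  rw [proj, dif_neg]
  rintro ⟨c, hc⟩
  exact c.nontrivial hc.symm

lemma exists_proj_eq_ray (hY : IsCAT0 Y) {q : Y} (hq : p ≠ q) : ∃ g : NontrivialGeodesic p,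
    g.endpoint = q ∧ proj p q = ray (g : SpaceOfDirections p) (dist p q) (dist_pos.2 hq) := by
  have h : ∃ c : NontrivialGeodesic p, c.endpoint = q := by
    obtain ⟨c, hc⟩ := hY.exists_geodesic p q
    exact ⟨⟨c, 1, q, hc, hq⟩, rfl⟩
  exact ⟨h.choose, h.choose_spec, by rw [proj, dif_pos h]⟩

/-- The points of the tangent cone whose direction is that of a geodesic. -/
def IsGeometric (v : TangentCone p) : Prop :=
  v = apex ∨ ∃ (c : NontrivialGeodesic p) (r : ℝ) (hr : 0 < r), v = ray c r hr

lemma isGeometric_proj (hY : IsCAT0 Y) (q : Y) : IsGeometric (proj p q) := by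
  by_cases hq : p = q
  · subst hq; exact Or.inl proj_self
  · obtain ⟨g, -, hg⟩ := exists_proj_eq_ray hY hq
    exact Or.inr ⟨g, _, _, hg⟩

/-- Angles are at most comparison angles. The length r is independent of the scale s, so a fixed
cone point can be tested by points of Y arbitrarily near p. -/
lemma sub_dist_sq_le_innerProduct (hY : IsCAT0 Y) (c : NontrivialGeodesic p) {s : ℝ}
    (hs : s ∈ Ioc 0 c.len) (r : ℝ) (hr : 0 < r) (q : Y) :
    r * (dist p (c.toFun s) ^ 2 + dist p q ^ 2 - dist (c.toFun s) q ^ 2) ≤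
      2 * dist p (c.toFun s) * innerProduct (ray c r hr) (proj p q) := by
  by_cases hq : p = q
  · subst hq
    rw [proj_self, innerProduct_apex, dist_self, dist_comm p]
    simp
  · obtain ⟨g, rfl, hg⟩ := exists_proj_eq_ray hY hq
    have := NontrivialGeodesic.sub_dist_sq_le hY c g hs g.len_mem
    rw [g.isGeodesic.target] at this
    rw [hg, innerProduct_ray, pairing, UniformSpace.Completion.dist_eq]
    change _ ≤ _ * (_ * (r * Real.cos (NontrivialGeodesic.angle c g)))
    nlinarith

/-- The projection to the tangent cone does not increase distances. -/
lemma sub_dist_sq_le_innerProduct_proj (hY : IsCAT0 Y) (x q : Y) :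
    dist p x ^ 2 + dist p q ^ 2 - dist x q ^ 2 ≤ 2 * innerProduct (proj p x) (proj p q) := by
  by_cases hx : p = x
  · subst hx
    rw [proj_self]
    have : innerProduct apex (proj p q) = 0 := by cases proj p q <;> rfl
    rw [this, dist_self]; simp
  · obtain ⟨g, rfl, hg⟩ := exists_proj_eq_ray hY hx
    have h := sub_dist_sq_le_innerProduct hY g g.len_mem _ (dist_pos.2 hx) q
    rw [← hg, g.isGeodesic.target] at h
    have := dist_pos.2 hx
    refine le_of_mul_le_mul_left ?_ this
    linarith

/-- An approximate midpoint, taken in `Y` at a small scale, of two points of length `M` of the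
tangent cone. -/
lemma eventually_le_innerProduct_midpoint (hY : IsCAT0 Y) {v : TangentCone p} (hv : IsGeometric v)
    (c c' : NontrivialGeodesic p) {M η : ℝ} (hM : 0 < M) (hη : 0 < η) :
    ∀ᶠ s in 𝓝[>] (0 : ℝ), ∀ e : ℝ → Y, IsGeodesic e 1 (c.point (M * s)) (c'.point (M * s)) →
      dist p (e (1 / 2)) ^ 2 - M ^ 2 * s ^ 2 +
        M * s ^ 2 * (pairing v c + pairing v c' - 2 * η * v.length) +
        1 / 2 * (M ^ 2 * s ^ 2) * (1 - Real.cos (NontrivialGeodesic.angle c c')) ≤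
      2 * s * innerProduct v (proj p (e (1 / 2))) := by
  have hhalf : (1 / 2 : ℝ) ∈ Icc (0 : ℝ) 1 := by constructor <;> norm_num
  have hbase : ∀ᶠ s in 𝓝[>] (0 : ℝ), 2 * (M ^ 2 * s ^ 2) *
      (1 - Real.cos (NontrivialGeodesic.angle c c')) ≤
      dist (c.point (M * s)) (c'.point (M * s)) ^ 2 ∧
      dist p (c.point (M * s)) = M * s ∧ dist p (c'.point (M * s)) = M * s := by
    filter_upwards [c.eventually_mem_Ioo hM, c'.eventually_mem_Ioo hM] with s hs hs'
    have h1 := NontrivialGeodesic.sub_dist_sq_le hY c c' ⟨hs.1, hs.2.le⟩ ⟨hs'.1, hs'.2.le⟩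
    have d1 := c.dist_point hs
    have d2 := c'.dist_point hs'
    refine ⟨?_, d1, d2⟩
    unfold NontrivialGeodesic.point at d1 d2 ⊢
    rw [d1, d2] at h1
    linarith
  rcases hv with rfl | ⟨a, r, hr, rfl⟩
  · filter_upwards [hbase] with s ⟨h1, h2, h3⟩ e he
    have h4 := hY.dist_sq_le_of_point he p hhalf
    rw [dist_comm _ p, dist_comm _ p, dist_comm _ p, h2, h3] at h4
    have h5 : innerProduct apex (proj p (e (1 / 2))) = 0 := by cases proj p (e (1 / 2)) <;> rfl
    rw [h5]
    simp only [pairing, length]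
    nlinarith
  · filter_upwards [hbase, a.eventually_mem_Ioo hr, a.eventually_dist_sq_le c hr hM hη,
      a.eventually_dist_sq_le c' hr hM hη, self_mem_nhdsWithin] with s ⟨h1, h2, h3⟩ ha h6 h7 hs e he
    have hs : 0 < s := hs
    -- The midpoint inequality seen from the point of Y that represents sv; `h5` then converts the
    -- distance to an inner product.
    have h4 := hY.dist_sq_le_of_point he (a.point (r * s)) hhalf
    have h5 := sub_dist_sq_le_innerProduct hY a ⟨ha.1, ha.2.le⟩ r hr (e (1 / 2))
    change r * (dist p (a.point (r * s)) ^ 2 + dist p (e (1 / 2)) ^ 2 -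
      dist (a.point (r * s)) (e (1 / 2)) ^ 2) ≤ 2 * dist p (a.point (r * s)) * _ at h5
    rw [a.dist_point ha] at h5
    have h5' : (r * s) ^ 2 + dist p (e (1 / 2)) ^ 2 - dist (a.point (r * s)) (e (1 / 2)) ^ 2 ≤
        2 * s * innerProduct (ray a r hr) (proj p (e (1 / 2))) := by
      refine le_of_mul_le_mul_left ?_ hr
      linarith
    rw [dist_comm _ (a.point (r * s)), dist_comm _ (a.point (r * s)),
      dist_comm _ (a.point (r * s))] at h4
    refine le_trans ?_ h5'
    simp only [pairing, length, UniformSpace.Completion.dist_eq]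
    change _ + M * s ^ 2 * (r * Real.cos (NontrivialGeodesic.angle a c) +
      r * Real.cos (NontrivialGeodesic.angle a c') - 2 * η * r) + _ ≤ _
    linarith

section Barycenter

variable {ι : Type*} {w : ι → ℝ} {v : ι → TangentCone p} {S : Finset ι}

/-- The mean of the inner products with a direction. -/
def meanPairing (S : Finset ι) (w : ι → ℝ) (v : ι → TangentCone p) (u : SpaceOfDirections p) : ℝ :=
  ∑ i ∈ S, w i * pairing (v i) u

lemma continuous_meanPairing : Continuous (meanPairing S w v) := by
  have := fun i => continuous_pairing (v i)
  unfold meanPairing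
  fun_prop

lemma sum_innerProduct_proj_le (hY : IsCAT0 Y) {M : ℝ}
    (h : ∀ c : NontrivialGeodesic p, meanPairing S w v c ≤ M) (q : Y) :
    ∑ i ∈ S, w i * innerProduct (v i) (proj p q) ≤ M * dist p q := by
  by_cases hq : p = q
  · subst hq
    simp [proj_self, innerProduct_apex]
  · obtain ⟨g, -, hg⟩ := exists_proj_eq_ray hY hq
    have := mul_le_mul_of_nonneg_left (h g) (dist_nonneg (x := p) (y := q))
    rw [hg]
    simp only [innerProduct_ray]
    rw [meanPairing, Finset.mul_sum] at this
    rw [mul_comm M]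
    refine le_trans (le_of_eq ?_) this
    exact Finset.sum_congr rfl fun i _ => by ring

/-- Directions that almost maximize the mean inner product are close to each other. -/
lemma one_sub_cos_angle_le (hY : IsCAT0 Y) (hw : ∀ i, 0 ≤ w i) (h1 : ∑ i ∈ S, w i = 1)
    (hv : ∀ i, IsGeometric (v i)) {M : ℝ} (hM : 0 < M)
    (hle : ∀ c : NontrivialGeodesic p, meanPairing S w v c ≤ M) (c c' : NontrivialGeodesic p) :
    M * (1 - Real.cos (NontrivialGeodesic.angle c c')) ≤
      2 * (2 * M - meanPairing S w v c - meanPairing S w v c') := by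
  set R := ∑ i ∈ S, w i * (v i).length with hR
  set θ := NontrivialGeodesic.angle c c'
  suffices h : 1 / 2 * M * (1 - Real.cos θ) -
      (2 * M - meanPairing S w v c - meanPairing S w v c') ≤ 0 by linarith
  refine nonpos_of_forall_le_mul (K := 2 * R) fun η hη => ?_
  have hev := (Finset.eventually_all S).2 fun i _ =>
    eventually_le_innerProduct_midpoint hY (hv i) c c' hM hη.1
  obtain ⟨s, hs, hs0⟩ := (hev.and self_mem_nhdsWithin).exists
  have hs0 : 0 < s := hs0
  obtain ⟨e, he⟩ := hY.exists_geodesic (c.point (M * s)) (c'.point (M * s))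
  have hsum := Finset.sum_le_sum fun i (hi : i ∈ S) =>
    mul_le_mul_of_nonneg_left (hs i hi e he) (hw i)
  have hm := mul_le_mul_of_nonneg_left (sum_innerProduct_proj_le hY hle (e (1 / 2)))
    (show 0 ≤ 2 * s by positivity)
  set δ := dist p (e (1 / 2))
  have e1 : ∑ i ∈ S, w i * (2 * s * innerProduct (v i) (proj p (e (1 / 2)))) =
      2 * s * ∑ i ∈ S, w i * innerProduct (v i) (proj p (e (1 / 2))) := by
    rw [Finset.mul_sum]
    exact Finset.sum_congr rfl fun i _ => by ring
  have e2 : ∑ i ∈ S, w i * (δ ^ 2 - M ^ 2 * s ^ 2 +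
        M * s ^ 2 * (pairing (v i) c + pairing (v i) c' - 2 * η * (v i).length) +
        1 / 2 * (M ^ 2 * s ^ 2) * (1 - Real.cos θ)) =
      (δ ^ 2 - M ^ 2 * s ^ 2 + 1 / 2 * (M ^ 2 * s ^ 2) * (1 - Real.cos θ)) * ∑ i ∈ S, w i +
        M * s ^ 2 * meanPairing S w v c + M * s ^ 2 * meanPairing S w v c' -
        M * s ^ 2 * 2 * η * R := by
    simp only [hR, meanPairing, Finset.mul_sum, ← Finset.sum_add_distrib,
      ← Finset.sum_sub_distrib]
    exact Finset.sum_congr rfl fun i _ => by ring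
  rw [e1, e2, h1] at hsum
  refine le_of_mul_le_mul_left ?_ (show 0 < M * s ^ 2 by positivity)
  -- The mean inner product with the midpoint is at most Mδ, and 2Msδ ≤ δ² + M²s² eliminates the
  -- unknown distance δ.
  nlinarith [sq_nonneg (δ - M * s)]

lemma finsum_eq_sum_mul (hS : Function.support w ⊆ S) (h : ι → ℝ) :
    ∑ᶠ i, w i * h i = ∑ i ∈ S, w i * h i :=
  finsum_eq_sum_of_support_subset _ fun _ hi => hS (left_ne_zero_of_mul hi)

lemma finsum_dist_apex_sq (hS : Function.support w ⊆ S) :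
    ∑ᶠ i, w i * dist (v i) apex ^ 2 = ∑ i ∈ S, w i * (v i).length ^ 2 := by
  simp only [dist_apex_sq]
  exact finsum_eq_sum_mul hS _

/-- In a fixed direction the functional is a quadratic in t, minimal at t = m(u) when the mean
pairing m(u) is positive. Finding a barycenter thus amounts to maximizing m. -/
lemma finsum_dist_ray_sq (hS : Function.support w ⊆ S) (h1 : ∑ i ∈ S, w i = 1)
    (u : SpaceOfDirections p) (t : ℝ) (ht : 0 < t) :
    ∑ᶠ i, w i * dist (v i) (ray u t ht) ^ 2 =
      ∑ i ∈ S, w i * (v i).length ^ 2 + (t ^ 2 - 2 * t * meanPairing S w v u) := by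
  simp only [dist_ray_sq]
  rw [finsum_eq_sum_mul hS fun i => (v i).length ^ 2 + t ^ 2 - 2 * t * pairing (v i) u]
  have : t ^ 2 = t ^ 2 * ∑ i ∈ S, w i := by rw [h1, mul_one]
  nth_rewrite 2 [this]
  rw [meanPairing]
  simp only [Finset.mul_sum, ← Finset.sum_add_distrib, ← Finset.sum_sub_distrib]
  exact Finset.sum_congr rfl fun i _ => by ring

/-- A barycenter bounds the mean inner products with all directions. -/
lemma IsBarycenter.meanPairing_le (hS : Function.support w ⊆ S) (h1 : ∑ i ∈ S, w i = 1)
    {b : TangentCone p} (hb : IsBarycenter w v b) (u : SpaceOfDirections p) :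
    meanPairing S w v u ≤ b.length := by
  by_contra! hlt
  have hpos : 0 < meanPairing S w v u := (length_nonneg b).trans_lt hlt
  have h2 := hb (ray u _ hpos)
  rw [finsum_dist_ray_sq hS h1] at h2
  cases b with
  | apex =>
    rw [finsum_dist_apex_sq hS] at h2
    nlinarith
  | ray u' t ht =>
    simp only [length] at hlt
    rw [finsum_dist_ray_sq hS h1] at h2
    -- Minimality against the apex makes the mean pairing with u' positive, and minimality within
    -- the ray then makes it equal to t. The value -t² cannot beat that of a direction with larger
    -- mean pairing.
    have h3 := hb apex
    rw [finsum_dist_apex_sq hS, finsum_dist_ray_sq hS h1] at h3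
    have h4 : 0 < meanPairing S w v u' := by nlinarith
    have h5 := hb (ray u' _ h4)
    rw [finsum_dist_ray_sq hS h1, finsum_dist_ray_sq hS h1] at h5
    have h6 : t = meanPairing S w v u' := by nlinarith
    nlinarith

/-- Barycenters exist. -/
lemma exists_isBarycenter (hY : IsCAT0 Y) (hS : Function.support w ⊆ S) (hw : ∀ i, 0 ≤ w i)
    (h1 : ∑ i ∈ S, w i = 1) (hv : ∀ i, IsGeometric (v i)) : ∃ b, IsBarycenter w v b := by
  -- Bounds on directions of geodesics extend to the completion by continuity.
  have hdense : ∀ {M : ℝ}, (∀ c : NontrivialGeodesic p, meanPairing S w v c ≤ M) →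
      ∀ u, meanPairing S w v u ≤ M := fun h u =>
    UniformSpace.Completion.induction_on u
      (isClosed_le continuous_meanPairing continuous_const) h
  -- Without a direction of positive mean pairing, in particular without any direction, the apex is
  -- a barycenter.
  by_cases h0 : ∀ c : NontrivialGeodesic p, meanPairing S w v c ≤ 0
  · refine ⟨apex, fun q => ?_⟩
    cases q with
    | apex => exact le_rfl
    | ray u t ht =>
      rw [finsum_dist_ray_sq hS h1, finsum_dist_apex_sq hS]
      nlinarith [hdense h0 u]
  push Not at h0
  obtain ⟨c₀, hc₀⟩ := h0
  have hbdd : BddAbove (range fun c : NontrivialGeodesic p => meanPairing S w v c) := by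
    refine ⟨∑ i ∈ S, w i * (v i).length, ?_⟩
    rintro _ ⟨c, rfl⟩
    exact Finset.sum_le_sum fun i _ =>
      mul_le_mul_of_nonneg_left (pairing_le_length _ _) (hw i)
  set M := sSup (range fun c : NontrivialGeodesic p => meanPairing S w v c) with hMdef
  have hle : ∀ c : NontrivialGeodesic p, meanPairing S w v c ≤ M := fun c =>
    le_csSup hbdd (mem_range_self c)
  have hM : 0 < M := hc₀.trans_le (hle c₀)
  have happrox : ∀ k : ℕ, ∃ c : NontrivialGeodesic p,
      M - 1 / ((k : ℝ) + 1) < meanPairing S w v c := fun k => by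
    obtain ⟨_, ⟨c, rfl⟩, hc⟩ := exists_lt_of_lt_csSup (range_nonempty_iff_nonempty.2 ⟨c₀⟩)
      (show M - 1 / ((k : ℝ) + 1) < M from sub_lt_self _ Nat.one_div_pos_of_nat)
    exact ⟨c, hc⟩
  choose g hg using happrox
  have hcauchy : CauchySeq fun k => (g k : SpaceOfDirections p) := by
    rw [Metric.cauchySeq_iff']
    intro ε hε
    obtain ⟨N, hN⟩ := exists_nat_one_div_lt
      (show 0 < ε ^ 2 * M / (2 * Real.pi ^ 2) by positivity)
    refine ⟨N, fun k hk => ?_⟩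
    rw [UniformSpace.Completion.dist_eq]
    change NontrivialGeodesic.angle (g k) (g N) < ε
    have h2 := one_sub_cos_angle_le hY hw h1 hv hM hle (g k) (g N)
    have a0 := NontrivialGeodesic.angle_nonneg (g k) (g N)
    -- On [0, π], 1 - cos θ ≥ 2θ²/π², so a small defect in the mean pairings bounds the angle.
    have h3 := mul_le_mul_of_nonneg_left (Real.cos_le_one_sub_mul_cos_sq
      ((abs_of_nonneg a0).trans_le (NontrivialGeodesic.angle_le_pi (g k) (g N)))) hM.le
    have h4 : 1 / ((k : ℝ) + 1) ≤ 1 / ((N : ℝ) + 1) := Nat.one_div_le_one_div hk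
    have h5 := hg k
    have h6 := hg N
    set θ := NontrivialGeodesic.angle (g k) (g N)
    have h7 : M * (2 / Real.pi ^ 2 * θ ^ 2) < 4 * (ε ^ 2 * M / (2 * Real.pi ^ 2)) := by linarith
    have h8 : 2 * M / Real.pi ^ 2 * θ ^ 2 < 2 * M / Real.pi ^ 2 * ε ^ 2 := by
      convert h7 using 1 <;> ring
    exact lt_of_pow_lt_pow_left₀ 2 hε.le (lt_of_mul_lt_mul_left h8 (by positivity))
  obtain ⟨u, hu⟩ := cauchySeq_tendsto_of_complete hcauchy
  have hMu : M ≤ meanPairing S w v u := by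
    have t1 : Tendsto (fun k : ℕ => M - 1 / ((k : ℝ) + 1)) atTop (𝓝 (M - 0)) :=
      tendsto_const_nhds.sub tendsto_one_div_add_atTop_nhds_zero_nat
    rw [sub_zero] at t1
    exact le_of_tendsto_of_tendsto' t1 ((continuous_meanPairing.tendsto u).comp hu)
      fun k => (hg k).le
  refine ⟨ray u M hM, fun q => ?_⟩
  rw [finsum_dist_ray_sq hS h1]
  cases q with
  | apex =>
    rw [finsum_dist_apex_sq hS]
    nlinarith
  | ray u' t ht =>
    rw [finsum_dist_ray_sq hS h1]
    nlinarith [hdense hle u', sq_nonneg (t - M)]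

end Barycenter

end TangentCone

/-- A map is almost harmonic up to the length of its Laplacian. -/
lemma almostHarmonic_length_negLaplacian {Γ Y : Type*} [Group Γ] [MetricSpace Y] (hY : IsCAT0 Y)
    {μ : Γ → Γ → ℝ} (hμ : IsRandomWalk μ) (f : Γ → Y) :
    AlmostHarmonic μ f (negLaplacian μ f).length := by
  have hS : Function.support (μ 1) ⊆ hμ.steps := fun b hb => by
    simpa [IsRandomWalk.steps] using hb
  -- Existence is essential: otherwise `negLaplacian` would be the default apex, of length 0.
  have hex := TangentCone.exists_isBarycenter (v := fun a => TangentCone.proj (f 1) (f a)) hY hS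
    (hμ.nonneg 1) hμ.sum_steps fun a => TangentCone.isGeometric_proj hY (f a)
  have hb : TangentCone.IsBarycenter (μ 1) (fun a => TangentCone.proj (f 1) (f a))
      (negLaplacian μ f) := by
    rw [negLaplacian, TangentCone.barycenter, dif_pos hex]
    exact hex.choose_spec
  intro q
  have h1 := TangentCone.sum_innerProduct_proj_le (S := hμ.steps) (w := μ 1)
    (v := fun a => TangentCone.proj (f 1) (f a)) hY
    (fun c => hb.meanPairing_le hS hμ.sum_steps c) q
  have h2 := Finset.sum_le_sum fun a (_ : a ∈ hμ.steps) => mul_le_mul_of_nonneg_left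
    (TangentCone.sub_dist_sq_le_innerProduct_proj (p := f 1) hY (f a) q) (hμ.nonneg 1 a)
  rw [two_mul_energy hμ, hμ.finsum_step]
  have e1 : ∑ a ∈ hμ.steps, μ 1 a * (dist (f 1) (f a) ^ 2 + dist (f 1) q ^ 2 -
      dist (f a) q ^ 2) = ∑ a ∈ hμ.steps, μ 1 a * dist (f 1) (f a) ^ 2 +
      dist (f 1) q ^ 2 * ∑ a ∈ hμ.steps, μ 1 a - ∑ a ∈ hμ.steps, μ 1 a * dist (f a) q ^ 2 := by
    simp only [Finset.mul_sum, ← Finset.sum_add_distrib, ← Finset.sum_sub_distrib]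
    exact Finset.sum_congr rfl fun a _ => by ring
  have e2 : ∑ a ∈ hμ.steps, μ 1 a * (2 * TangentCone.innerProduct
      (TangentCone.proj (f 1) (f a)) (TangentCone.proj (f 1) q)) =
      2 * ∑ a ∈ hμ.steps, μ 1 a * TangentCone.innerProduct
      (TangentCone.proj (f 1) (f a)) (TangentCone.proj (f 1) q) := by
    rw [Finset.mul_sum]
    exact Finset.sum_congr rfl fun a _ => by ring
  rw [e1, e2, hμ.sum_steps] at h2
  linarith

end NStepEnergy

end

theorem mainTheorem9 {Γ : Type*} [Group Γ] [Group.FG Γ]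
    {Y : Type*} [MetricSpace Y] [CompleteSpace Y] [Nonempty Y] (hY : IsCAT0 Y)
    (μ : Γ → Γ → ℝ) (hμ : IsRandomWalk μ) (ρ : Γ →* (Y ≃ᵢ Y))
    (n : ℕ) (hn : 0 < n) (ε : ℝ) (hε : 0 < ε)
    (h : ∀ f : Γ → Y, IsEquivariant ρ f →
      ∃ l : ℕ, 1 ≤ l ∧ l ≤ n ∧ energy (convPow μ l) f ≤ ((l : ℝ) - ε) * energy μ f) :
    (∃ C : ℝ, 0 < C ∧ ∀ f : Γ → Y, IsEquivariant ρ f →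
      C * energy μ f ≤ (negLaplacian μ f).length ^ 2) ∧
    ∃ p : Y, ∀ γ : Γ, ρ γ p = p := by
  have hn' : (0 : ℝ) < n := by exact_mod_cast hn
  constructor
  · refine ⟨2 * ε ^ 2 / n ^ 4, by positivity, fun f hf => ?_⟩
    obtain ⟨l, -, hln, hl⟩ := h f hf
    have := (almostHarmonic_length_negLaplacian hY hμ f).energy_le hμ hf
      (TangentCone.length_nonneg _) hln hε hl
    rw [div_mul_eq_mul_div, div_le_iff₀ (by positivity)]
    linarith
  -- With this κ the estimate reads 2ε²E ≤ n⁴κ²E = ε²E, which leaves only E = 0.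
  · have hκ : 0 < ε / (n : ℝ) ^ 2 := by positivity
    obtain ⟨p, hp⟩ := exists_forall_le_add_mul_dist (continuous_energy_orbitMap hμ ρ).sqrt
      (fun _ => Real.sqrt_nonneg _) hκ
    have hp' := almostHarmonic_of_almost_minimizer hY hμ ρ hκ hp
    have hf := isEquivariant_orbitMap ρ p
    obtain ⟨l, -, hln, hl⟩ := h _ hf
    have hE := energy_nonneg hμ (orbitMap ρ p)
    have h1 := hp'.energy_le hμ hf (by positivity) hln hε hl
    rw [mul_pow, Real.sq_sqrt hE, div_pow, ← mul_assoc,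
      show (n : ℝ) ^ 4 * (ε ^ 2 / ((n : ℝ) ^ 2) ^ 2) = ε ^ 2 by field_simp] at h1
    have h2 : 0 < ε ^ 2 := by positivity
    exact ⟨p, fixed_of_energy_eq_zero hμ ρ (by nlinarith)⟩
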